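/- Let $\mathcal H_{\rm hol}$ be the Bargmann space, i.e. the Hilbert space of entire functions in $L^2(\mathbb C,\pi^{-1}e^{-|z|^2}\,dx\,dy)$, and let $\Phi_n(z)=z^n/\sqrt{n!}$, $n=0,1,2,\dots$ On $\mathcal H_{\rm hol}$ let $K_+=\tfrac12 z^2$ and $K_-=\tfrac12\partial_z^2$, each with its maximal domain (all $f\in\mathcal H_{\rm hol}$ that it maps into $\mathcal H_{\rm hol}$). For $\xi\in\mathbb C$ let $S(\xi)=\exp(\xi K_+-\bar\xi K_-)$, that is, $S(\xi)=U(1)$ where $(U(t))_{t\in\mathbb R}$ is the strongly continuous one-parameter unitary group on $\mathcal H_{\rm hol}$ whose infinitesimal generator is the closure of $\xi K_+-\bar\xi K_-$ (defined on the intersection of the two domains). Let $H_n(z)=n!\sum_{m=0}^{\lfloor n/2\rfloor}\frac{(-1)^m(2z)^{n-2m}}{m!\,(n-2m)!}$ be the Hermite polynomials in a complex variable. Theorem. Let $\xi\in\mathbb C$ be nonzero and $\zeta=\frac{\tanh|\xi|}{|\xi|}\,\xi$. Then the unitary operator $S(\xi)$ exists and is unique, and the squeezed basis vectors $\Phi_n^\xi=S(\xi)\Phi_n$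 are given, for all $n\ge 0$ and $z\in\mathbb C$, by $$\Phi_n^\xi(z)=(1-|\zeta|^2)^{1/4}\,e^{\frac{\zeta}{2}z^2}\,\frac{\bar\zeta^{\,n/2}}{\sqrt{2^n n!}}\,H_n\!\left(\sqrt{\tfrac{1-|\zeta|^2}{2\bar\zeta}}\;z\right),$$ where the complex roots are understood as follows: $\sqrt{\bar\zeta}$ is either of the two square roots of $\bar\zeta$, the same in both places, $\bar\zeta^{\,n/2}=(\sqrt{\bar\zeta})^n$, and $\sqrt{\tfrac{1-|\zeta|^2}{2\bar\zeta}}=\sqrt{\tfrac{1-|\zeta|^2}{2}}\,\big/\sqrt{\bar\zeta}$ with the nonnegative square root in the numerator. -/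

import Mathlib

open MeasureTheory
open scoped ComplexConjugate

noncomputable section

/-- The measure `π⁻¹ exp (-|z|²) dx dy` on `ℂ`. -/
def bargmannMeasure : Measure ℂ :=
  (volume : Measure ℂ).withDensity fun z => ENNReal.ofReal (Real.pi⁻¹ * Real.exp (-‖z‖ ^ 2))

/-- The vector space of entire functions. -/
def entireFunctions : Submodule ℂ (ℂ → ℂ) where
  carrier := {F | Differentiable ℂ F}
  zero_mem' := differentiable_const 0
  add_mem' hF hG := hF.add hG
  smul_mem' c _ hF := hF.const_smul c

/-- The Bargmann space: the subspace of `L²(ℂ, π⁻¹ exp (-|z|²) dx dy)` of all classes that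
contain an entire function. Norm and inner product are those of `L²`. -/
def bargmannSpace : Submodule ℂ (Lp ℂ 2 bargmannMeasure) where
  carrier := {f | ∃ F ∈ entireFunctions, f =ᵐ[bargmannMeasure] F}
  zero_mem' := ⟨0, entireFunctions.zero_mem, Lp.coeFn_zero _ _ _⟩
  add_mem' := by
    rintro f g ⟨F, hF, hfF⟩ ⟨G, hG, hgG⟩
    exact ⟨F + G, entireFunctions.add_mem hF hG, (Lp.coeFn_add f g).trans (hfF.add hgG)⟩
  smul_mem' := by
    rintro c f ⟨F, hF, hfF⟩
    refine ⟨c • F, entireFunctions.smul_mem c hF, (Lp.coeFn_smul c f).trans ?_⟩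
    filter_upwards [hfF] with z hz
    simp [hz]

theorem bargmannMeasure_ae_le : ae (volume : Measure ℂ) ≤ ae bargmannMeasure := by
  refine (withDensity_absolutelyContinuous' (by fun_prop) ?_).ae_le
  filter_upwards with z
  have : 0 < Real.pi⁻¹ * Real.exp (-‖z‖ ^ 2) := by positivity
  simpa using this

theorem entireFunctions_eq_of_ae {F G : ℂ → ℂ} (hF : F ∈ entireFunctions)
    (hG : G ∈ entireFunctions) (h : F =ᵐ[bargmannMeasure] G) : F = G := by
  have hF' : Differentiable ℂ F := hF
  have hG' : Differentiable ℂ G := hG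
  exact Continuous.ae_eq_iff_eq volume hF'.continuous hG'.continuous |>.1
    (bargmannMeasure_ae_le h)

/-- The entire function that represents an element of the Bargmann space. -/
def entireRep : bargmannSpace →ₗ[ℂ] entireFunctions where
  toFun f := ⟨f.2.choose, f.2.choose_spec.1⟩
  map_add' f g := by
    refine Subtype.ext (entireFunctions_eq_of_ae (f + g).2.choose_spec.1
      (entireFunctions.add_mem f.2.choose_spec.1 g.2.choose_spec.1) ?_)
    exact (f + g).2.choose_spec.2.symm.trans ((Lp.coeFn_add f.1 g.1).trans
      (f.2.choose_spec.2.add g.2.choose_spec.2))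
  map_smul' c f := by
    refine Subtype.ext (entireFunctions_eq_of_ae (c • f).2.choose_spec.1
      (entireFunctions.smul_mem c f.2.choose_spec.1) ?_)
    refine (c • f).2.choose_spec.2.symm.trans ((Lp.coeFn_smul c f.1).trans ?_)
    filter_upwards [f.2.choose_spec.2] with z hz
    simp [hz]

theorem entireRep_ae (f : bargmannSpace) :
    (f : Lp ℂ 2 bargmannMeasure) =ᵐ[bargmannMeasure] (entireRep f : ℂ → ℂ) :=
  f.2.choose_spec.2

theorem entireRep_injective : Function.Injective entireRep := by
  intro f g h
  refine Subtype.ext (Lp.ext ?_)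
  exact (entireRep_ae f).trans (by rw [h]; exact (entireRep_ae g).symm)

/-- The operator on the Bargmann space given by a linear map `T` on entire functions, with its
maximal domain: all `f` in the Bargmann space for which `T f` is again in the Bargmann space. -/
def maximalOperator (T : entireFunctions →ₗ[ℂ] entireFunctions) :
    bargmannSpace →ₗ.[ℂ] bargmannSpace where
  domain := (LinearMap.range entireRep).comap (T ∘ₗ entireRep)
  toFun := (LinearEquiv.ofInjective entireRep entireRep_injective).symm.toLinearMap ∘ₗ
    (T ∘ₗ entireRep).restrict fun _ hf => hf

theorem mem_maximalOperator_graph (T : entireFunctions →ₗ[ℂ] entireFunctions)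
    (f g : bargmannSpace) :
    (f, g) ∈ (maximalOperator T).graph ↔ entireRep g = T (entireRep f) := by
  rw [LinearPMap.mem_graph_iff]
  constructor
  · rintro ⟨⟨x, hx⟩, rfl, rfl⟩
    exact congrArg Subtype.val ((LinearEquiv.ofInjective entireRep
      entireRep_injective).apply_symm_apply ⟨T (entireRep x), hx⟩)
  · intro h
    refine ⟨⟨f, ⟨g, h⟩⟩, rfl, ?_⟩
    apply (LinearEquiv.ofInjective entireRep entireRep_injective).injective
    refine ((LinearEquiv.ofInjective entireRep
      entireRep_injective).apply_symm_apply ⟨T (entireRep f), ⟨g, h⟩⟩).trans ?_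
    exact Subtype.ext h.symm

/-- `F ↦ z² F / 2` on entire functions. -/
def halfSqMul : entireFunctions →ₗ[ℂ] entireFunctions where
  toFun F := ⟨fun z => z ^ 2 / 2 * F.1 z, by
    have hF : Differentiable ℂ F.1 := F.2
    exact ((differentiable_id.pow 2).div_const 2).mul hF⟩
  map_add' F G := by
    ext z
    simp [mul_add]
  map_smul' c F := by
    ext z
    simp only [Submodule.coe_smul, Pi.smul_apply, smul_eq_mul, RingHom.id_apply]
    ring

/-- The complex derivative on entire functions. -/
def entireDeriv : entireFunctions →ₗ[ℂ] entireFunctions where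
  toFun F := ⟨deriv F.1, by
    have hF : Differentiable ℂ F.1 := F.2
    exact hF.deriv⟩
  map_add' F G := by
    have hF : Differentiable ℂ F.1 := F.2
    have hG : Differentiable ℂ G.1 := G.2
    ext z
    exact deriv_add (hF z) (hG z)
  map_smul' c F := by
    have hF : Differentiable ℂ F.1 := F.2
    ext z
    exact deriv_const_smul c (hF z)

/-- `K₊ = z² / 2` on the Bargmann space. -/
def Kplus : bargmannSpace →ₗ.[ℂ] bargmannSpace := maximalOperator halfSqMul

/-- `K₋ = ∂² / 2` on the Bargmann space. -/
def Kminus : bargmannSpace →ₗ.[ℂ] bargmannSpace :=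
  maximalOperator ((1 / 2 : ℂ) • (entireDeriv ∘ₗ entireDeriv))

/-- A strongly continuous one-parameter group of unitary operators. -/
structure UnitaryGroup (H : Type*) [NormedAddCommGroup H] [InnerProductSpace ℂ H] where
  op : ℝ → (H ≃ₗᵢ[ℂ] H)
  op_add : ∀ s t, op (s + t) = op s * op t
  continuous_op : ∀ x, Continuous fun t => op t x

/-- `S = exp A` for an unbounded operator `A`: there is a strongly continuous one-parameter
unitary group `U` (that is, `U t = exp (t A)`) whose infinitesimal generator is exactly `A`, and
`S = U 1`. -/
def IsUnitaryExp {H : Type*} [NormedAddCommGroup H] [InnerProductSpace ℂ H]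
    (A : H →ₗ.[ℂ] H) (S : H ≃ₗᵢ[ℂ] H) : Prop :=
  ∃ U : UnitaryGroup H,
    (∀ x y : H, (x, y) ∈ A.graph ↔ HasDerivAt (fun t => U.op t x) y 0) ∧ U.op 1 = S

open Classical in
/-- The exponential of an unbounded operator `A` that generates a unitary group
(the identity, as a default value, if `A` does not). -/
def unitaryExp {H : Type*} [NormedAddCommGroup H] [InnerProductSpace ℂ H]
    (A : H →ₗ.[ℂ] H) : H ≃ₗᵢ[ℂ] H :=
  if h : ∃ S, IsUnitaryExp A S then h.choose else 1

/-- The closure of `ξ K₊ - ξ̄ K₋`, which is initially given on the intersection of the domains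
of `K₊` and `K₋`. -/
def squeezeGenerator (ξ : ℂ) : bargmannSpace →ₗ.[ℂ] bargmannSpace :=
  (ξ • Kplus - conj ξ • Kminus).closure

/-- The squeeze operator `S(ξ) = exp (ξ K₊ - ξ̄ K₋)`. -/
def squeezeOperator (ξ : ℂ) : bargmannSpace ≃ₗᵢ[ℂ] bargmannSpace :=
  unitaryExp (squeezeGenerator ξ)

theorem memLp_monomial (n : ℕ) :
    MemLp (fun z : ℂ => z ^ n / (Real.sqrt n.factorial : ℂ)) 2 bargmannMeasure := by
  have hc : Continuous fun z : ℂ => z ^ n / (Real.sqrt n.factorial : ℂ) := by fun_prop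
  have hfac : (0 : ℝ) < n.factorial := by exact_mod_cast n.factorial_pos
  rw [memLp_two_iff_integrable_sq_norm hc.aestronglyMeasurable, bargmannMeasure,
    integrable_withDensity_iff (by fun_prop) (by simp)]
  have hg : Integrable (fun z : ℂ => 2 ^ n * Real.pi⁻¹ * Real.exp (-(1 / 2) * ‖z‖ ^ 2)) := by
    have h := (GaussianFourier.integrable_cexp_neg_mul_sq_norm_add (V := ℂ)
      (b := (1 / 2 : ℂ)) (by norm_num) 0 0).norm
    refine (h.congr ?_).const_mul _
    filter_upwards with z
    rw [Complex.norm_exp]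
    congr 1
    simp [← Complex.ofReal_pow]
  refine hg.mono' (by fun_prop) ?_
  filter_upwards with z
  have hpos : 0 ≤ Real.pi⁻¹ * Real.exp (-‖z‖ ^ 2) := by positivity
  have hpow := Real.pow_div_factorial_le_exp (‖z‖ ^ 2 / 2) (by positivity) n
  rw [ENNReal.toReal_ofReal hpos, Real.norm_of_nonneg (by positivity), norm_div, norm_pow,
    div_pow, Complex.norm_real, Real.norm_of_nonneg (Real.sqrt_nonneg _),
    Real.sq_sqrt hfac.le]
  have hexp : Real.exp (-(1 / 2) * ‖z‖ ^ 2) =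
      Real.exp (‖z‖ ^ 2 / 2) * Real.exp (-‖z‖ ^ 2) := by
    rw [← Real.exp_add]
    ring_nf
  rw [hexp]
  have hle : (‖z‖ ^ n) ^ 2 / n.factorial ≤ 2 ^ n * Real.exp (‖z‖ ^ 2 / 2) := by
    calc (‖z‖ ^ n) ^ 2 / n.factorial = 2 ^ n * ((‖z‖ ^ 2 / 2) ^ n / n.factorial) := by
          rw [div_pow]
          field_simp
          ring
      _ ≤ _ := by gcongr
  calc _ ≤ 2 ^ n * Real.exp (‖z‖ ^ 2 / 2) * (Real.pi⁻¹ * Real.exp (-‖z‖ ^ 2)) := by gcongr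
    _ = _ := by ring

/-- The basis vector `Φₙ(z) = zⁿ / √(n!)` of the Bargmann space. -/
def fockBasis (n : ℕ) : bargmannSpace :=
  ⟨(memLp_monomial n).toLp, fun z => z ^ n / (Real.sqrt n.factorial : ℂ),
    (differentiable_id.pow n).div_const _, (memLp_monomial n).coeFn_toLp⟩

/-- The squeezed basis vector `Φₙ^ξ = S(ξ) Φₙ`. -/
def squeezedBasis (ξ : ℂ) (n : ℕ) : bargmannSpace := squeezeOperator ξ (fockBasis n)

/-- The (physicists') Hermite polynomial `Hₙ` in a complex variable. -/
def hermiteH (n : ℕ) (z : ℂ) : ℂ :=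
  (n.factorial : ℂ) * ∑ m ∈ Finset.range (n / 2 + 1),
    (-1) ^ m * (2 * z) ^ (n - 2 * m) / ((m.factorial : ℂ) * ((n - 2 * m).factorial : ℂ))

/-- `ζ = tanh(|ξ|) ξ / |ξ|`. -/
def squeezeParam (ξ : ℂ) : ℂ := (Real.tanh ‖ξ‖ : ℂ) * ξ / (‖ξ‖ : ℂ)

end

/-! The evolution equation `x' = (ξ K₊ - ξ̄ K₋) x` can be solved explicitly when it starts at a
coherent state `e^{bz}`. The Gaussian ansatz `exp (a z²/2 + β z + c)` turns it into the Riccati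
equation `a' = ξ - ξ̄ a²` with two equations for `β` and `c`. The solutions are elementary in `tanh`
and `cosh` of `|ξ| t`, and `|a| < 1` keeps the curve in the Bargmann space for all real `t`
(`hasDerivAt_squeezedCoherent`).

These curves also settle the operator theory. On the maximal domains `ξ K₊ - ξ̄ K₋` is
skew-symmetric (`isSkewRelation_squeeze`), because `K₊` and `K₋` are formal adjoints by Parseval.
Coherent states are reproducing kernels, hence total. A skew-symmetric operator with globally
defined solution curves that are total at time 0 has a closure that generates a unitary group: the
flow preserves inner products, so it extends to unitaries, and a vector orthogonal to the range of
`A - 1` would pair with a curve of constant norm to give exponential growth. This is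
`exists_isUnitaryExp_of_curves`, which gives existence, uniqueness and the value of `S` on coherent
states together.

Finally `e^{bz} = ∑ bⁿ/√(n!) Φₙ`, so the functions `S Φₙ` are read off from the powers of `b` in the
squeezed coherent state. As a function of `b` that state is the Hermite generating function up to a
factor independent of `b` (`entireRep_squeezed_apply`). -/

noncomputable section

local notation "⟪" x ", " y "⟫" => @inner ℂ _ InnerProductSpace.toInner x y

/-! ### Skew-symmetric relations and generators of unitary groups -/

section AbstractGenerator

variable {H : Type*} [NormedAddCommGroup H] [InnerProductSpace ℂ H]

/-- A linear relation is skew-symmetric if `⟪T x, y⟫ = -⟪x, T y⟫` on its domain. -/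
def IsSkewRelation (R : Submodule ℂ (H × H)) : Prop :=
  ∀ p ∈ R, ∀ q ∈ R, ⟪p.2, q.1⟫ = -⟪p.1, q.2⟫

/-- The derivative `⟪x', y⟫ + ⟪x, y'⟫` vanishes by skewness. Every isometry and uniqueness statement
about flows below rests on this conservation law. -/
theorem IsSkewRelation.inner_const {R : Submodule ℂ (H × H)} (hR : IsSkewRelation R)
    {x x' y y' : ℝ → H} (hx : ∀ t, (x t, x' t) ∈ R) (hy : ∀ t, (y t, y' t) ∈ R)
    (hdx : ∀ t, HasDerivAt x (x' t) t) (hdy : ∀ t, HasDerivAt y (y' t) t) (s t : ℝ) :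
    ⟪x s, y s⟫ = ⟪x t, y t⟫ := by
  have hd : ∀ t, HasDerivAt (fun t => ⟪x t, y t⟫) 0 t := fun t => by
    have h := (hdx t).inner ℂ (hdy t)
    rwa [hR _ (hx t) _ (hy t), add_neg_cancel] at h
  exact is_const_of_deriv_eq_zero (fun t => (hd t).differentiableAt) (fun t => (hd t).deriv) s t

/-- Skewness gives `Re ⟪p.2, p.1⟫ = 0`, so `‖p.2 - p.1‖² = ‖p.1‖² + ‖p.2‖²`, which bounds both
components. Thus `A - 1` controls the graph norm. -/
theorem IsSkewRelation.norm_le {R : Submodule ℂ (H × H)} (hR : IsSkewRelation R)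
    {p : H × H} (hp : p ∈ R) : ‖p‖ ≤ ‖p.2 - p.1‖ := by
  have h := hR p hp p hp
  have hre : RCLike.re ⟪p.2, p.1⟫ = 0 := by
    have h1 := congrArg RCLike.re h
    rw [map_neg, inner_re_symm (𝕜 := ℂ) p.1 p.2] at h1
    linarith
  have h2 := norm_sub_sq (𝕜 := ℂ) p.2 p.1
  rw [hre] at h2
  refine max_le ?_ ?_ <;> refine abs_le_of_sq_le_sq' ?_ (norm_nonneg _) |>.2 <;>
    nlinarith [sq_nonneg ‖p.1‖, sq_nonneg ‖p.2‖]

namespace UnitaryGroup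

variable (U : UnitaryGroup H)

theorem op_zero : U.op 0 = 1 := by
  have h := U.op_add 0 0
  rw [add_zero] at h
  exact left_eq_mul.1 h

theorem op_add_apply (s t : ℝ) (x : H) : U.op (s + t) x = U.op s (U.op t x) := by
  rw [U.op_add]; rfl

theorem op_zero_apply (x : H) : U.op 0 x = x := by
  rw [U.op_zero]; rfl

theorem inner_op_right (t : ℝ) (x y : H) : ⟪x, U.op t y⟫ = ⟪U.op (-t) x, y⟫ := by
  rw [← (U.op (-t)).inner_map_map x, ← U.op_add_apply, neg_add_cancel, U.op_zero_apply]

theorem hasDerivAt_of_zero {x y : H} (h : HasDerivAt (fun t => U.op t x) y 0) (s : ℝ) :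
    HasDerivAt (fun t => U.op t x) (U.op s y) s := by
  have h1 : HasDerivAt (fun t => U.op (t - s) x) y s := by
    have h0 : HasDerivAt (fun t => U.op t x) y (s - s) := by rwa [sub_self]
    simpa using h0.comp_sub_const s s
  have h2 := ((U.op s).toContinuousLinearEquiv.toContinuousLinearMap.restrictScalars
    ℝ).hasFDerivAt.comp_hasDerivAt s h1
  refine h2.congr_of_eventuallyEq (Filter.Eventually.of_forall fun t => ?_)
  have := U.op_add_apply s (t - s) x
  rw [add_sub_cancel] at this
  exact this

/-- The infinitesimal generator of a unitary group, as a linear relation. -/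
def generator : Submodule ℂ (H × H) where
  carrier := {p | HasDerivAt (fun t => U.op t p.1) p.2 0}
  zero_mem' := by
    simpa using hasDerivAt_const (0 : ℝ) (0 : H)
  add_mem' {p q} hp hq := by
    have hp' : HasDerivAt (fun t => U.op t p.1) p.2 0 := hp
    have hq' : HasDerivAt (fun t => U.op t q.1) q.2 0 := hq
    refine (hp'.add hq').congr_of_eventuallyEq (Filter.Eventually.of_forall fun t => ?_)
    simp
  smul_mem' c p hp := by
    have hp' : HasDerivAt (fun t => U.op t p.1) p.2 0 := hp
    refine (hp'.const_smul c).congr_of_eventuallyEq (Filter.Eventually.of_forall fun t => ?_)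
    simp

theorem mem_generator {p : H × H} :
    p ∈ U.generator ↔ HasDerivAt (fun t => U.op t p.1) p.2 0 := Iff.rfl

theorem op_mem_generator {x y : H} (h : (x, y) ∈ U.generator) (t : ℝ) :
    (U.op t x, U.op t y) ∈ U.generator := by
  have h1 := U.hasDerivAt_of_zero h t
  rw [mem_generator]
  have h2 : HasDerivAt (fun s => U.op s x) (U.op t y) (0 + t) := by rwa [zero_add]
  simpa only [U.op_add_apply] using h2.comp_add_const 0 t

theorem isSkewRelation_generator : IsSkewRelation U.generator := by
  intro p hp q hq
  have h := HasDerivAt.inner ℂ (U.mem_generator.1 hp) (U.mem_generator.1 hq)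
  simp only [LinearIsometryEquiv.inner_map_map] at h
  have h0 := h.unique (hasDerivAt_const _ _)
  rw [op_zero_apply, op_zero_apply] at h0
  exact eq_neg_of_add_eq_zero_right h0

/-- For `x` in the common domain, `⟪U t x, V t x⟫` is conserved and so equals `‖x‖²`. Expanding the
square then gives `‖U t x - V t x‖ = 0`. -/
theorem op_eq_of_generator_eq {U V : UnitaryGroup H} (h : U.generator = V.generator)
    (hd : Dense {x : H | ∃ y, (x, y) ∈ U.generator}) : U.op = V.op := by
  funext t
  refine DFunLike.coe_injective ((U.op t).continuous.ext_on hd (V.op t).continuous ?_)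
  rintro x ⟨y, hy⟩
  have hy' : (x, y) ∈ V.generator := h ▸ hy
  have hc := U.isSkewRelation_generator.inner_const (fun t => U.op_mem_generator hy t)
    (fun t => h ▸ V.op_mem_generator hy' t) (U.hasDerivAt_of_zero hy)
    (V.hasDerivAt_of_zero hy') t 0
  rw [op_zero_apply, op_zero_apply] at hc
  have hn := norm_sub_sq (𝕜 := ℂ) (U.op t x) (V.op t x)
  rw [hc, LinearIsometryEquiv.norm_map, LinearIsometryEquiv.norm_map,
    inner_self_eq_norm_sq] at hn
  have h0 : ‖U.op t x - V.op t x‖ ^ 2 = 0 := by rw [hn]; ring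
  exact sub_eq_zero.1 (norm_eq_zero.1 (pow_eq_zero_iff two_ne_zero |>.1 h0))

/-- The integrated form of the evolution equation is continuous in `(x, y)` for each `t`, unlike the
derivative. This makes the generator closed. -/
theorem mem_generator_iff_integral [CompleteSpace H] {x y : H} :
    (x, y) ∈ U.generator ↔ ∀ t, U.op t x - x = ∫ s in (0 : ℝ)..t, U.op s y := by
  have hc := U.continuous_op y
  constructor
  · intro h t
    rw [intervalIntegral.integral_eq_sub_of_hasDerivAt
      (fun s _ => U.hasDerivAt_of_zero h s) (hc.intervalIntegrable _ _), op_zero_apply]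
  · intro h
    have h1 := (intervalIntegral.integral_hasDerivAt_right (hc.intervalIntegrable 0 0)
      (hc.stronglyMeasurableAtFilter _ _) hc.continuousAt).add_const x
    rw [op_zero_apply] at h1
    refine h1.congr_of_eventuallyEq (Filter.Eventually.of_forall fun t => ?_)
    simp [← h t]

theorem isClosed_generator [CompleteSpace H] :
    IsClosed (U.generator : Set (H × H)) := by
  have : (U.generator : Set (H × H)) =
      ⋂ t, {p | U.op t p.1 - p.1 = ∫ s in (0 : ℝ)..t, U.op s p.2} := by
    ext ⟨x, y⟩
    simp only [SetLike.mem_coe, U.mem_generator_iff_integral, Set.mem_iInter, Set.mem_ofPred_eq]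
  rw [this]
  refine isClosed_iInter fun t => isClosed_eq ?_ ?_
  · exact ((U.op t).continuous.comp continuous_fst).sub continuous_fst
  · refine Continuous.comp (g := fun y => ∫ s in (0 : ℝ)..t, U.op s y) ?_ continuous_snd
    refine LipschitzWith.continuous (K := ⟨|t|, abs_nonneg t⟩)
      (LipschitzWith.of_dist_le_mul fun y z => ?_)
    rw [dist_eq_norm, ← intervalIntegral.integral_sub
      ((U.continuous_op y).intervalIntegrable _ _) ((U.continuous_op z).intervalIntegrable _ _)]
    refine (intervalIntegral.norm_integral_le_of_norm_le_const (C := ‖y - z‖)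
      fun s _ => ?_).trans ?_
    · rw [← map_sub, LinearIsometryEquiv.norm_map]
    · rw [sub_zero, mul_comm, dist_eq_norm]; rfl

end UnitaryGroup


theorem norm_linearCombination_eq {ι : Type*} {x y : ι → H} (h : ∀ i j, ⟪x i, x j⟫ = ⟪y i, y j⟫)
    (f : ι →₀ ℂ) : ‖Finsupp.linearCombination ℂ x f‖ = ‖Finsupp.linearCombination ℂ y f‖ := by
  have : ⟪Finsupp.linearCombination ℂ x f, Finsupp.linearCombination ℂ x f⟫ =
      ⟪Finsupp.linearCombination ℂ y f, Finsupp.linearCombination ℂ y f⟫ := by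
    simp only [Finsupp.linearCombination_apply, Finsupp.sum, sum_inner, inner_sum,
      inner_smul_left, inner_smul_right, h]
  rw [inner_self_eq_norm_sq_to_K, inner_self_eq_norm_sq_to_K] at this
  have h2 : ‖Finsupp.linearCombination ℂ x f‖ ^ 2 = ‖Finsupp.linearCombination ℂ y f‖ ^ 2 := by
    exact_mod_cast this
  exact (pow_left_inj₀ (norm_nonneg _) (norm_nonneg _) two_ne_zero).1 h2

/-- Equal Gram matrices make `x i ↦ y i` isometric on finite linear combinations. Totality on both
sides makes the extension onto. -/
theorem exists_isometryEquiv_of_inner_eq [CompleteSpace H] {ι : Type*} {x y : ι → H}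
    (hx : Dense (Submodule.span ℂ (Set.range x) : Set H))
    (hy : Dense (Submodule.span ℂ (Set.range y) : Set H))
    (h : ∀ i j, ⟪y i, y j⟫ = ⟪x i, x j⟫) : ∃ V : H ≃ₗᵢ[ℂ] H, ∀ i, V (x i) = y i := by
  have dx : DenseRange (Finsupp.linearCombination ℂ x) := by
    rwa [DenseRange, ← LinearMap.coe_range, Finsupp.range_linearCombination]
  have dy : DenseRange (Finsupp.linearCombination ℂ y) := by
    rwa [DenseRange, ← LinearMap.coe_range, Finsupp.range_linearCombination]
  refine ⟨(LinearEquiv.refl ℂ (ι →₀ ℂ)).extendOfIsometry _ _ dx dy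
    (norm_linearCombination_eq h), fun i => ?_⟩
  have := (LinearEquiv.refl ℂ (ι →₀ ℂ)).extendOfIsometry_eq _ _ dx dy
    (norm_linearCombination_eq h) (Finsupp.single i 1)
  simpa using this

theorem eq_zero_of_dense_span {ι : Type*} {x : ι → H}
    (hx : Dense (Submodule.span ℂ (Set.range x) : Set H)) {y : H} (h : ∀ i, ⟪x i, y⟫ = 0) :
    y = 0 := by
  refine hx.eq_zero_of_inner_left (𝕜 := ℂ) fun v hv => ?_
  rw [← inner_eq_zero_symm]
  change v ∈ Submodule.span ℂ (Set.range x) at hv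
  induction hv using Submodule.span_induction with
  | mem v hv => obtain ⟨i, rfl⟩ := hv; exact h i
  | zero => simp
  | add a b _ _ ha hb => rw [inner_add_left, ha, hb, add_zero]
  | smul c a _ ha => rw [inner_smul_left, ha, mul_zero]

theorem eq_of_dense_span {ι : Type*} {x : ι → H}
    (hx : Dense (Submodule.span ℂ (Set.range x) : Set H)) {y z : H}
    (h : ∀ i, ⟪x i, y⟫ = ⟪x i, z⟫) : y = z :=
  sub_eq_zero.1 (eq_zero_of_dense_span hx fun i => by rw [inner_sub_right, h, sub_self])

/-! ### Unitary groups from total families of solution curves -/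

section Curves

variable {ι : Type*} {R : Submodule ℂ (H × H)} {g g' : ι → ℝ → H}

theorem inner_curve_add (hR : IsSkewRelation R)
    (hg : ∀ i t, (g i t, g' i t) ∈ R) (hd : ∀ i t, HasDerivAt (g i) (g' i t) t)
    (i j : ι) (a b r : ℝ) : ⟪g i (a + r), g j (b + r)⟫ = ⟪g i a, g j b⟫ := by
  have h := hR.inner_const (x := fun r => g i (a + r)) (y := fun r => g j (b + r))
    (fun t => hg i (a + t)) (fun t => hg j (b + t))
    (fun t => (hd i (a + t)).comp_const_add a t) (fun t => (hd j (b + t)).comp_const_add b t) r 0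
  simpa using h

theorem exists_isometry_of_inner_eq [CompleteSpace H] {x y : ι → H}
    (hx : Dense (Submodule.span ℂ (Set.range x) : Set H))
    (h : ∀ i j, ⟪y i, y j⟫ = ⟪x i, x j⟫) :
    ∃ V : H →L[ℂ] H, (∀ i, V (x i) = y i) ∧ ∀ v, ‖V v‖ = ‖v‖ := by
  have dx : DenseRange (Finsupp.linearCombination ℂ x) := by
    rwa [DenseRange, ← LinearMap.coe_range, Finsupp.range_linearCombination]
  have hn := norm_linearCombination_eq h
  have hb : ∃ C, ∀ f, ‖Finsupp.linearCombination ℂ y f‖ ≤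
    C * ‖Finsupp.linearCombination ℂ x f‖ := ⟨1, fun f => by rw [one_mul, hn]⟩
  refine ⟨(Finsupp.linearCombination ℂ y).extendOfNorm (Finsupp.linearCombination ℂ x),
    fun i => ?_, fun v => ?_⟩
  · simpa using LinearMap.extendOfNorm_eq dx hb (Finsupp.single i 1)
  · refine dx.induction_on (p := fun v => ‖_‖ = ‖v‖) v
      (isClosed_eq (ContinuousLinearMap.continuous _).norm continuous_norm) fun f => ?_
    rw [LinearMap.extendOfNorm_eq dx hb, hn]

/-- The isometry `W : g i 0 ↦ g i (-t)` satisfies `⟪W y, g i 0⟫ = ⟪y, g i t⟫`. A vector `y`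
orthogonal to every `g i t` therefore has `W y = 0`, hence `y = 0`. Surjectivity of `W` is not
needed. -/
theorem dense_span_curves [CompleteSpace H] (hR : IsSkewRelation R)
    (hg : ∀ i t, (g i t, g' i t) ∈ R) (hd : ∀ i t, HasDerivAt (g i) (g' i t) t)
    (h0 : Dense (Submodule.span ℂ (Set.range fun i => g i 0) : Set H)) (t : ℝ) :
    Dense (Submodule.span ℂ (Set.range fun i => g i t) : Set H) := by
  have key := inner_curve_add hR hg hd
  obtain ⟨W, hW, hWn⟩ := exists_isometry_of_inner_eq (y := fun i => g i (-t)) h0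
    fun i j => by simpa using key i j 0 0 (-t)
  have hadj : ∀ i y, ⟪W y, g i 0⟫ = ⟪y, g i t⟫ := by
    intro i y
    refine h0.induction (P := fun y => ⟪W y, g i 0⟫ = ⟪y, g i t⟫) (fun y hy => ?_)
      (isClosed_eq (W.continuous.inner continuous_const)
        (continuous_id.inner continuous_const)) y
    change y ∈ Submodule.span ℂ (Set.range fun i => g i 0) at hy
    induction hy using Submodule.span_induction with
    | mem v hv =>
      obtain ⟨j, rfl⟩ := hv
      rw [hW]
      simpa using key j i 0 t (-t)
    | zero => simp
    | add a b _ _ ha hb => rw [map_add, inner_add_left, inner_add_left, ha, hb]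
    | smul c a _ ha => rw [map_smul, inner_smul_left, inner_smul_left, ha]
  refine Submodule.dense_iff_topologicalClosure_eq_top.2
    ((Submodule.topologicalClosure_eq_top_iff).2 ((Submodule.eq_bot_iff _).2 fun y hy => ?_))
  have hWy : W y = 0 := eq_zero_of_dense_span h0 fun i => by
    rw [← inner_conj_symm, hadj, inner_conj_symm]
    exact (Submodule.mem_orthogonal _ _).1 hy _ (Submodule.subset_span ⟨i, rfl⟩)
  rw [← norm_eq_zero, ← hWn, hWy, norm_zero]

/-- Total families of solution curves of a skew-symmetric relation define a unitary group. -/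
theorem exists_unitaryGroup_of_curves [CompleteSpace H] (hR : IsSkewRelation R)
    (hg : ∀ i t, (g i t, g' i t) ∈ R) (hd : ∀ i t, HasDerivAt (g i) (g' i t) t)
    (htot : ∀ t, Dense (Submodule.span ℂ (Set.range fun i => g i t) : Set H)) :
    ∃ U : UnitaryGroup H, ∀ i s t, U.op s (g i t) = g i (t + s) := by
  have key := inner_curve_add hR hg hd
  choose V hV using fun t => exists_isometryEquiv_of_inner_eq (htot 0) (htot t)
    fun i j => by simpa using key i j 0 0 t
  -- `V s` is prescribed only on the initial vectors. Pairing with `g j s = V s (g j 0)`, a total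
  -- family, determines it along whole curves.
  have hVt : ∀ i s t, V s (g i t) = g i (t + s) := by
    intro i s t
    refine eq_of_dense_span (htot s) fun j => ?_
    rw [← hV s j, LinearIsometryEquiv.inner_map_map, hV]
    simpa using (key j i 0 t s).symm
  refine ⟨⟨V, fun s t => ?_, fun x => ?_⟩, hVt⟩
  · refine LinearIsometryEquiv.ext fun x => eq_of_dense_span (htot (0 + t + s)) fun i => ?_
    rw [LinearIsometryEquiv.coe_mul, Function.comp_apply, ← hVt i s, ← hVt i t,
      LinearIsometryEquiv.inner_map_map, LinearIsometryEquiv.inner_map_map, hVt, hVt, add_assoc,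
      add_comm t s, ← hVt i (s + t), LinearIsometryEquiv.inner_map_map]
  -- Strong continuity is clear on the span of the initial vectors. It passes to all of `H` by an
  -- `ε/3` argument, since every `V t` is isometric.
  · have hclosed : ∀ x ∈ Submodule.span ℂ (Set.range fun i => g i 0),
        Continuous fun t => V t x := by
      intro x hx
      induction hx using Submodule.span_induction with
      | mem v hv =>
        obtain ⟨i, rfl⟩ := hv
        simp only [hV]
        exact continuous_iff_continuousAt.2 fun t => (hd i t).continuousAt
      | zero => simpa using continuous_const
      | add a b _ _ ha hb => simp only [map_add]; exact ha.add hb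
      | smul c a _ ha => simp only [map_smul]; exact ha.const_smul c
    rw [Metric.continuous_iff]
    intro t ε hε
    obtain ⟨y, hy, hxy⟩ := (htot 0).exists_dist_lt x (by positivity : 0 < ε / 3)
    obtain ⟨δ, hδ, h⟩ := Metric.continuous_iff.1 (hclosed y hy) t (ε / 3) (by positivity)
    refine ⟨δ, hδ, fun s hs => ?_⟩
    have h1 := h s hs
    have h2 : dist (V s x) (V s y) < ε / 3 := by rwa [(V s).dist_map]
    have h3 : dist (V t y) (V t x) < ε / 3 := by rwa [(V t).dist_map, dist_comm]
    have h4 := dist_triangle4 (V s x) (V s y) (V t y) (V t x)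
    linarith

/-- Moving the group onto a test vector gives `⟪g i 0, U t x⟫ = ⟪g i (-t), x⟫`. By skewness the
derivative is `⟪g i (-t), y⟫ = ⟪g i 0, U t y⟫`, and integrating yields the integral form of the
generator weakly on a total set. -/
theorem relation_le_generator [CompleteSpace H] (hR : IsSkewRelation R)
    (hg : ∀ i t, (g i t, g' i t) ∈ R) (hd : ∀ i t, HasDerivAt (g i) (g' i t) t)
    (htot : ∀ t, Dense (Submodule.span ℂ (Set.range fun i => g i t) : Set H))
    {U : UnitaryGroup H} (hU : ∀ i s t, U.op s (g i t) = g i (t + s)) : R ≤ U.generator := by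
  rintro ⟨x, y⟩ hxy
  rw [U.mem_generator_iff_integral]
  intro t
  refine eq_of_dense_span (htot 0) fun i => ?_
  have hc := U.continuous_op y
  have h1 : ∀ t, HasDerivAt (fun t => ⟪g i 0, U.op t x - x⟫) ⟪g i 0, U.op t y⟫ t := by
    intro t
    have h2 : HasDerivAt (fun t => ⟪g i (-t), x⟫) ⟪-g' i (-t), x⟫ t := by
      have h3 : HasDerivAt (fun t => g i (-t)) (-g' i (-t)) t := by
        have := (hd i (-t)).scomp t (hasDerivAt_neg t)
        rwa [neg_one_smul] at this
      simpa using h3.inner ℂ (hasDerivAt_const t x)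
    rw [inner_neg_left, hR _ (hg i (-t)) _ hxy, neg_neg] at h2
    have h4 := h2.sub_const ⟪g i 0, x⟫
    rw [U.inner_op_right, hU, zero_add]
    refine h4.congr_of_eventuallyEq (Filter.Eventually.of_forall fun s => ?_)
    simp only
    rw [inner_sub_right, U.inner_op_right, hU, zero_add]
  have h5 : (∫ s in (0 : ℝ)..t, ⟪g i 0, U.op s y⟫) = ⟪g i 0, ∫ s in (0 : ℝ)..t, U.op s y⟫ :=
    ((innerSL ℂ (g i 0)).intervalIntegral_comp_comm (hc.intervalIntegrable _ _))
  rw [← h5, intervalIntegral.integral_eq_sub_of_hasDerivAt (fun s _ => h1 s)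
    ((continuous_const.inner hc).intervalIntegrable _ _)]
  simp [U.op_zero_apply]

/-- Such a `y` satisfies `⟪g i t, y⟫' = ⟪g i t, y⟫`, so the pairing grows like `e^t`. It is also
bounded because `‖g i t‖` is constant, so it must vanish. -/
theorem dense_sub_of_curves (hR : IsSkewRelation R)
    (hg : ∀ i t, (g i t, g' i t) ∈ R) (hd : ∀ i t, HasDerivAt (g i) (g' i t) t)
    (htot : ∀ t, Dense (Submodule.span ℂ (Set.range fun i => g i t) : Set H)) {y : H}
    (hy : ∀ p ∈ R, ⟪p.2 - p.1, y⟫ = 0) : y = 0 := by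
  refine eq_zero_of_dense_span (htot 0) fun i => ?_
  have h1 : ∀ t, HasDerivAt (fun t => ⟪g i t, y⟫) ⟪g i t, y⟫ t := by
    intro t
    have h2 := (hd i t).inner ℂ (hasDerivAt_const t y)
    rw [inner_zero_right, zero_add] at h2
    have h3 := hy _ (hg i t)
    rw [inner_sub_left, sub_eq_zero] at h3
    rwa [h3] at h2
  have h4 : ∀ t, ⟪g i t, y⟫ = Real.exp t * ⟪g i 0, y⟫ := by
    intro t
    have h5 : ∀ t, HasDerivAt (fun t : ℝ => (Real.exp (-t) : ℂ) * ⟪g i t, y⟫) 0 t := by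
      intro t
      have h6 : HasDerivAt (fun t : ℝ => (Real.exp (-t) : ℂ)) (-Real.exp (-t) : ℂ) t := by
        have := ((Real.hasDerivAt_exp (-t)).comp t (hasDerivAt_neg t)).ofReal_comp
        simpa using this
      have := h6.mul (h1 t)
      rwa [neg_mul, neg_add_cancel] at this
    have h7 := is_const_of_deriv_eq_zero (fun t => (h5 t).differentiableAt)
      (fun t => (h5 t).deriv) t 0
    simp only [neg_zero, Real.exp_zero, Complex.ofReal_one, one_mul] at h7
    rw [← h7, ← mul_assoc, ← Complex.ofReal_mul, ← Real.exp_add]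
    simp
  have hb : ∀ t, Real.exp t * ‖⟪g i 0, y⟫‖ ≤ ‖g i 0‖ * ‖y‖ := by
    intro t
    have hn : ‖g i t‖ = ‖g i 0‖ := by
      have := hR.inner_const (hg i) (hg i) (hd i) (hd i) t 0
      rw [inner_self_eq_norm_sq_to_K, inner_self_eq_norm_sq_to_K] at this
      have h2 : ‖g i t‖ ^ 2 = ‖g i 0‖ ^ 2 := by exact_mod_cast this
      exact (pow_left_inj₀ (norm_nonneg _) (norm_nonneg _) two_ne_zero).1 h2
    have := norm_inner_le_norm (𝕜 := ℂ) (g i t) y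
    rw [h4, hn, norm_mul, Complex.norm_real, Real.norm_of_nonneg (Real.exp_pos t).le] at this
    exact this
  by_contra hne
  have hpos : 0 < ‖⟪g i 0, y⟫‖ := norm_pos_iff.2 hne
  obtain ⟨t, ht⟩ := ((Real.tendsto_exp_atTop.atTop_mul_const hpos).eventually_gt_atTop
    (‖g i 0‖ * ‖y‖)).exists
  exact absurd (hb t) (not_le.2 ht)

/-- Since the range of `A - 1` is dense, some `q ∈ R` has `q.2 - q.1` close to `p.2 - p.1`. The
graph-norm estimate for the generator, applied to `p - q`, then puts `q` close to `p`. -/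
theorem generator_le_closure [CompleteSpace H] (hR : IsSkewRelation R)
    (hg : ∀ i t, (g i t, g' i t) ∈ R) (hd : ∀ i t, HasDerivAt (g i) (g' i t) t)
    (htot : ∀ t, Dense (Submodule.span ℂ (Set.range fun i => g i t) : Set H))
    {U : UnitaryGroup H} (hRU : R ≤ U.generator) : U.generator ≤ R.topologicalClosure := by
  intro p hp
  let D : H × H →ₗ[ℂ] H := LinearMap.snd ℂ H H - LinearMap.fst ℂ H H
  have hdense : (R.map D).topologicalClosure = ⊤ := by
    rw [Submodule.topologicalClosure_eq_top_iff, Submodule.eq_bot_iff]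
    intro y hy
    exact dense_sub_of_curves hR hg hd htot fun q hq =>
      (Submodule.mem_orthogonal _ _).1 hy _ ⟨q, hq, rfl⟩
  have hmem : p.2 - p.1 ∈ (R.map D).topologicalClosure := hdense ▸ Submodule.mem_top
  change p ∈ closure (R : Set (H × H))
  rw [Metric.mem_closure_iff]
  intro ε hε
  obtain ⟨_, ⟨q, hq, rfl⟩, hlt⟩ := Metric.mem_closure_iff.1 hmem ε hε
  refine ⟨q, hq, ?_⟩
  rw [dist_eq_norm] at hlt ⊢
  refine (U.isSkewRelation_generator.norm_le (sub_mem hp (hRU hq))).trans_lt ?_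
  have hD : (p - q).2 - (p - q).1 = p.2 - p.1 - D q := by
    change p.2 - q.2 - (p.1 - q.1) = p.2 - p.1 - (q.2 - q.1)
    abel
  rwa [hD]

theorem closure_graph_eq_generator [CompleteSpace H] {A : H →ₗ.[ℂ] H}
    (hA : IsSkewRelation A.graph)
    (hg : ∀ i t, (g i t, g' i t) ∈ A.graph) (hd : ∀ i t, HasDerivAt (g i) (g' i t) t)
    (htot : ∀ t, Dense (Submodule.span ℂ (Set.range fun i => g i t) : Set H))
    {U : UnitaryGroup H} (hU : ∀ i s t, U.op s (g i t) = g i (t + s)) :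
    A.closure.graph = U.generator := by
  have hle := relation_le_generator hA hg hd htot hU
  have heq : A.graph.topologicalClosure = U.generator :=
    le_antisymm (Submodule.topologicalClosure_minimal _ hle U.isClosed_generator)
      (generator_le_closure hA hg hd htot hle)
  -- `LinearPMap.closure` returns `A` itself when `A` is not closable, so this must be checked. The
  -- closed graph is single-valued because it is a generator and derivatives are unique.
  have hclosable : A.IsClosable := by
    refine ⟨U.generator.toLinearPMap, ?_⟩
    rw [Submodule.toLinearPMap_graph_eq, heq]
    rintro ⟨x, y⟩ hxy hx
    obtain rfl : x = 0 := hx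
    have h := U.mem_generator.1 hxy
    simp only [map_zero] at h
    exact h.unique (hasDerivAt_const _ _)
  rw [← hclosable.graph_closure_eq_closure_graph, heq]

/-- If the solution curves of `x' = A x` are total, the closure of a skew-symmetric `A` has
exactly one exponential, and this exponential is the time-one flow of the curves. -/
theorem exists_isUnitaryExp_of_curves [CompleteSpace H] {A : H →ₗ.[ℂ] H}
    (hA : IsSkewRelation A.graph)
    (hg : ∀ i t, (g i t, g' i t) ∈ A.graph) (hd : ∀ i t, HasDerivAt (g i) (g' i t) t)
    (h0 : Dense (Submodule.span ℂ (Set.range fun i => g i 0) : Set H)) :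
    ∃ S, IsUnitaryExp A.closure S ∧ (∀ S', IsUnitaryExp A.closure S' → S' = S) ∧
      ∀ i, S (g i 0) = g i 1 := by
  have htot := dense_span_curves hA hg hd h0
  obtain ⟨U, hU⟩ := exists_unitaryGroup_of_curves hA hg hd htot
  have hgen := closure_graph_eq_generator hA hg hd htot hU
  refine ⟨U.op 1, ⟨U, fun x y => by rw [hgen]; rfl, rfl⟩, ?_, fun i => by simpa using hU i 1 0⟩
  rintro _ ⟨V, hV, rfl⟩
  have hUV : U.generator = V.generator := by
    rw [← hgen]
    ext ⟨x, y⟩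
    exact hV x y
  rw [UnitaryGroup.op_eq_of_generator_eq hUV]
  refine (htot 0).mono fun x hx => ?_
  have hle : Submodule.span ℂ (Set.range fun i => g i 0) ≤
      U.generator.map (LinearMap.fst ℂ H H) := by
    rw [Submodule.span_le]
    rintro _ ⟨i, rfl⟩
    exact ⟨_, relation_le_generator hA hg hd htot hU (hg i 0), rfl⟩
  obtain ⟨⟨a, b⟩, hab, rfl⟩ := hle hx
  exact ⟨b, hab⟩

end Curves

end AbstractGenerator

/-- Uniqueness identifies the exponential picked by choice and rules out the default value. -/
theorem unitaryExp_eq {H : Type*} [NormedAddCommGroup H] [InnerProductSpace ℂ H]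
    {A : H →ₗ.[ℂ] H} {S : H ≃ₗᵢ[ℂ] H} (h : IsUnitaryExp A S)
    (huniq : ∀ S', IsUnitaryExp A S' → S' = S) : unitaryExp A = S := by
  have hex : ∃ S, IsUnitaryExp A S := ⟨S, h⟩
  rw [unitaryExp, dif_pos hex]
  exact huniq _ hex.choose_spec

/-! ### The Bargmann space: Taylor coefficients, evaluation, completeness, Gaussian bounds -/

section BargmannSpace

theorem integrable_bargmannMeasure_iff {h : ℂ → ℂ} : Integrable h bargmannMeasure ↔
    Integrable fun z => (Real.pi⁻¹ * Real.exp (-‖z‖ ^ 2)) • h z := by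
  rw [bargmannMeasure, integrable_withDensity_iff_integrable_smul' (by fun_prop) (by simp)]
  refine integrable_congr (Filter.Eventually.of_forall fun z => ?_)
  simp only
  rw [ENNReal.toReal_ofReal (by positivity)]

theorem integral_bargmannMeasure (h : ℂ → ℂ) : ∫ z, h z ∂bargmannMeasure =
    ∫ z, (Real.pi⁻¹ * Real.exp (-‖z‖ ^ 2)) • h z := by
  rw [bargmannMeasure, integral_withDensity_eq_integral_toReal_smul₀ (by fun_prop) (by simp)]
  refine integral_congr_ae (Filter.Eventually.of_forall fun z => ?_)
  simp only
  rw [ENNReal.toReal_ofReal (by positivity)]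

theorem circleMap_eq_polarCoord_symm (p : ℝ × ℝ) :
    Complex.polarCoord.symm p = circleMap 0 p.1 p.2 := by
  rw [Complex.polarCoord_symm_apply, circleMap, zero_add, Complex.exp_mul_I,
    Complex.ofReal_cos, Complex.ofReal_sin]

theorem integral_eq_integral_circle {h : ℂ → ℂ} (hc : Continuous h) (hi : Integrable h) :
    ∫ z, h z = ∫ r in Set.Ioi (0 : ℝ), r • ∫ θ in (0 : ℝ)..2 * Real.pi, h (circleMap 0 r θ) := by
  have hcm : Continuous fun p : ℝ × ℝ => circleMap 0 p.1 p.2 := by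
    unfold circleMap
    fun_prop
  have hint : IntegrableOn (fun p : ℝ × ℝ => p.1 • h (circleMap 0 p.1 p.2))
      (Set.Ioi 0 ×ˢ Set.Ioo (-Real.pi) Real.pi) := by
    refine ⟨(continuous_fst.smul (hc.comp hcm)).aestronglyMeasurable, ?_⟩
    have h1 := Complex.lintegral_comp_polarCoord_symm fun z => ‖h z‖ₑ
    have h2 : ∫⁻ z, ‖h z‖ₑ < ⊤ := hi.2
    rw [← h1, polarCoord_target] at h2
    refine lt_of_le_of_lt (le_of_eq (setLIntegral_congr_fun
      (measurableSet_Ioi.prod measurableSet_Ioo) fun p hp => ?_)) h2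
    have hp1 : 0 < p.1 := hp.1
    simp only [circleMap_eq_polarCoord_symm, enorm_smul, smul_eq_mul]
    rw [Real.enorm_eq_ofReal hp1.le]
  rw [← Complex.integral_comp_polarCoord_symm, polarCoord_target]
  simp only [circleMap_eq_polarCoord_symm]
  rw [Measure.volume_eq_prod, setIntegral_prod _ (by rwa [← Measure.volume_eq_prod])]
  refine setIntegral_congr_fun measurableSet_Ioi fun r _ => ?_
  simp only
  rw [integral_smul, ← integral_Ioc_eq_integral_Ioo,
    ← intervalIntegral.integral_of_le (by linarith [Real.pi_pos])]
  -- Polar coordinates use angles in `(-π, π)`, circle integrals use `[0, 2π]`. Periodicity bridges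
  -- the two.
  have hper : Function.Periodic (fun θ => h (circleMap 0 r θ)) (2 * Real.pi) :=
    fun θ => by simp only [periodic_circleMap 0 r θ]
  have := hper.intervalIntegral_add_eq (-Real.pi) 0
  rw [zero_add, show -Real.pi + 2 * Real.pi = Real.pi by ring] at this
  rw [this]

/-- On the circle `conj z = r²/z`, which turns the integral into Cauchy's formula for the `n`-th
derivative at 0. -/
theorem integral_circle_conj_pow_mul {F : ℂ → ℂ} (hF : Differentiable ℂ F) (n : ℕ) {r : ℝ}
    (hr : 0 < r) : ∫ θ in (0 : ℝ)..2 * Real.pi,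
      conj (circleMap 0 r θ) ^ n * F (circleMap 0 r θ) =
      2 * Real.pi * r ^ (2 * n) / n.factorial * iteratedDeriv n F 0 := by
  have h := hF.differentiableOn.circleIntegral_one_div_sub_center_pow_smul (c := 0) hr n
  have hint : ∀ θ : ℝ, conj (circleMap 0 r θ) ^ n * F (circleMap 0 r θ) =
      (r ^ (2 * n) / Complex.I) * (deriv (circleMap 0 r) θ •
        (1 / (circleMap 0 r θ - 0) ^ (n + 1)) • F (circleMap 0 r θ)) := by
    intro θ
    have hz : circleMap 0 r θ ≠ 0 := circleMap_ne_center hr.ne'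
    have hconj : conj (circleMap 0 r θ) = r ^ 2 / circleMap 0 r θ := by
      rw [eq_div_iff hz, mul_comm, Complex.mul_conj, Complex.normSq_eq_norm_sq,
        norm_circleMap_zero, sq_abs, Complex.ofReal_pow]
    rw [deriv_circleMap, hconj, smul_eq_mul, smul_eq_mul, div_pow, ← pow_mul, sub_zero]
    field_simp
    ring
  simp only [hint, intervalIntegral.integral_const_mul]
  rw [circleIntegral] at h
  rw [h, smul_eq_mul]
  field_simp

theorem integral_radial (n : ℕ) : ∫ r in Set.Ioi (0 : ℝ), r ^ (2 * n + 1) * Real.exp (-r ^ 2) =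
    n.factorial / 2 := by
  have h := integral_rpow_mul_exp_neg_rpow (p := 2) (q := 2 * n + 1) (by norm_num)
    (by have : (0 : ℝ) ≤ n := n.cast_nonneg
        linarith)
  rw [show ((2 * n + 1 + 1 : ℝ)) / 2 = n + 1 by ring, Real.Gamma_nat_eq_factorial] at h
  rw [div_eq_inv_mul, ← one_div, ← h]
  refine setIntegral_congr_fun measurableSet_Ioi fun r _ => ?_
  rw [← Real.rpow_natCast, ← Real.rpow_natCast]
  push_cast
  rfl

theorem integral_conj_pow_mul {F : ℂ → ℂ} (hF : Differentiable ℂ F) (n : ℕ)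
    (hi : Integrable (fun z => conj z ^ n * F z) bargmannMeasure) :
    ∫ z, conj z ^ n * F z ∂bargmannMeasure = iteratedDeriv n F 0 := by
  rw [integral_bargmannMeasure]
  have hFc := hF.continuous
  rw [integral_eq_integral_circle (by fun_prop) (integrable_bargmannMeasure_iff.1 hi)]
  have h1 : ∀ r ∈ Set.Ioi (0 : ℝ), (r • ∫ θ in (0 : ℝ)..2 * Real.pi,
      (Real.pi⁻¹ * Real.exp (-‖circleMap 0 r θ‖ ^ 2)) •
        (conj (circleMap 0 r θ) ^ n * F (circleMap 0 r θ))) =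
      ((r ^ (2 * n + 1) * Real.exp (-r ^ 2) : ℝ) : ℂ) *
        (2 / n.factorial * iteratedDeriv n F 0) := by
    intro r hr
    have hr' : 0 < r := hr
    simp only [norm_circleMap_zero, sq_abs]
    rw [intervalIntegral.integral_smul, integral_circle_conj_pow_mul hF n hr']
    simp only [Complex.real_smul]
    push_cast
    field_simp
    ring
  rw [setIntegral_congr_fun measurableSet_Ioi h1, integral_mul_const, integral_complex_ofReal,
    integral_radial]
  have : (n.factorial : ℂ) ≠ 0 := by exact_mod_cast n.factorial_ne_zero
  push_cast
  field_simp

theorem differentiable_entireRep (f : bargmannSpace) :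
    Differentiable ℂ (entireRep f : ℂ → ℂ) := (entireRep f).2

theorem integrable_conj_mul (f g : bargmannSpace) : Integrable
    (fun z => conj ((entireRep f : ℂ → ℂ) z) * (entireRep g : ℂ → ℂ) z) bargmannMeasure := by
  refine (L2.integrable_inner (𝕜 := ℂ) f.1 g.1).congr ?_
  filter_upwards [entireRep_ae f, entireRep_ae g] with z hf hg
  rw [hf, hg, RCLike.inner_apply, mul_comm]

theorem inner_eq_integral (f g : bargmannSpace) : ⟪f, g⟫ =
    ∫ z, conj ((entireRep f : ℂ → ℂ) z) * (entireRep g : ℂ → ℂ) z ∂bargmannMeasure := by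
  rw [Submodule.coe_inner, L2.inner_def]
  refine integral_congr_ae ?_
  filter_upwards [entireRep_ae f, entireRep_ae g] with z hf hg
  rw [hf, hg, RCLike.inner_apply, mul_comm]

/-- The element of the Bargmann space given by a square-integrable entire function. -/
def ofEntire (F : ℂ → ℂ) (hF : Differentiable ℂ F) (hM : MemLp F 2 bargmannMeasure) :
    bargmannSpace := ⟨hM.toLp, F, hF, hM.coeFn_toLp⟩

theorem entireRep_eq_of_ae {f : bargmannSpace} {F : ℂ → ℂ} (hF : Differentiable ℂ F)
    (h : f.1 =ᵐ[bargmannMeasure] F) : (entireRep f : ℂ → ℂ) = F :=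
  entireFunctions_eq_of_ae (entireRep f).2 hF ((entireRep_ae f).symm.trans h)

theorem entireRep_ofEntire (F : ℂ → ℂ) (hF : Differentiable ℂ F)
    (hM : MemLp F 2 bargmannMeasure) : (entireRep (ofEntire F hF hM) : ℂ → ℂ) = F :=
  entireRep_eq_of_ae hF hM.coeFn_toLp

theorem entireRep_fockBasis (n : ℕ) : (entireRep (fockBasis n) : ℂ → ℂ) =
    fun z => z ^ n / (Real.sqrt n.factorial : ℂ) :=
  entireRep_eq_of_ae ((differentiable_id.pow n).div_const _) (memLp_monomial n).coeFn_toLp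

theorem ofReal_sqrt_factorial_ne_zero (n : ℕ) : (Real.sqrt n.factorial : ℂ) ≠ 0 := by
  have : (0 : ℝ) < n.factorial := by exact_mod_cast n.factorial_pos
  exact_mod_cast (Real.sqrt_pos.2 this).ne'

theorem ofReal_sqrt_factorial_sq (n : ℕ) : (Real.sqrt n.factorial : ℂ) ^ 2 = n.factorial := by
  rw [← Complex.ofReal_pow, Real.sq_sqrt (by positivity), Complex.ofReal_natCast]

/-- This links the Hilbert space with the Taylor series: orthonormality, completeness of the basis
and the adjoint relation of `K₊` and `K₋` all reduce to it. -/
theorem inner_fockBasis (n : ℕ) (f : bargmannSpace) : ⟪fockBasis n, f⟫ =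
    iteratedDeriv n (entireRep f : ℂ → ℂ) 0 / (Real.sqrt n.factorial : ℂ) := by
  have hi := integrable_conj_mul (fockBasis n) f
  rw [inner_eq_integral]
  simp only [entireRep_fockBasis, map_div₀, map_pow, Complex.conj_ofReal, div_mul_eq_mul_div,
    integral_div] at hi ⊢
  rw [integral_conj_pow_mul (differentiable_entireRep f)]
  have := hi.mul_const (Real.sqrt n.factorial : ℂ)
  simpa only [div_mul_cancel₀ _ (ofReal_sqrt_factorial_ne_zero n)] using this

theorem hasSum_entireRep (f : bargmannSpace) (z : ℂ) : HasSum
    (fun n => z ^ n / (Real.sqrt n.factorial : ℂ) * ⟪fockBasis n, f⟫)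
    ((entireRep f : ℂ → ℂ) z) := by
  have h := Complex.hasSum_taylorSeries_of_entire (differentiable_entireRep f) 0 z
  refine h.congr_fun fun n => ?_
  rw [inner_fockBasis, sub_zero, smul_eq_mul, smul_eq_mul, ← ofReal_sqrt_factorial_sq]
  have := ofReal_sqrt_factorial_ne_zero n
  field_simp

theorem orthonormal_fockBasis : Orthonormal ℂ fockBasis := by
  rw [orthonormal_iff_ite]
  intro i j
  rw [inner_fockBasis, entireRep_fockBasis]
  have hd : iteratedDeriv i (fun z : ℂ => z ^ j / (Real.sqrt j.factorial : ℂ)) 0 =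
      iteratedDeriv i (fun z : ℂ => z ^ j) 0 / (Real.sqrt j.factorial : ℂ) := by
    simp only [div_eq_mul_inv]
    exact iteratedDeriv_mul_const_field _ _
  rw [hd, iteratedDeriv_pow]
  split_ifs with h
  · subst h
    have := ofReal_sqrt_factorial_ne_zero i
    rw [Nat.descFactorial_self, ← ofReal_sqrt_factorial_sq]
    field_simp
    simp
  · rcases lt_or_gt_of_ne h with h | h
    · simp [Nat.sub_ne_zero_of_lt h]
    · simp [Nat.descFactorial_eq_zero_iff_lt.2 h]

/-- Each partial sum of the Taylor series is an inner product of `f` with a truncated reproducing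
kernel, whose squared norm is a partial sum of `e^{|z|²}`. Cauchy–Schwarz then gives the bound. -/
theorem norm_entireRep_le (f : bargmannSpace) (z : ℂ) :
    ‖(entireRep f : ℂ → ℂ) z‖ ≤ Real.exp (‖z‖ ^ 2 / 2) * ‖f‖ := by
  refine le_of_tendsto (hasSum_entireRep f z).norm (Filter.Eventually.of_forall fun s => ?_)
  set c : ℕ → ℂ := fun n => z ^ n / (Real.sqrt n.factorial : ℂ)
  have h1 : ∑ n ∈ s, c n * ⟪fockBasis n, f⟫ = ⟪∑ n ∈ s, conj (c n) • fockBasis n, f⟫ := by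
    rw [sum_inner]
    refine Finset.sum_congr rfl fun n _ => ?_
    have := inner_smul_left (𝕜 := ℂ) (fockBasis n) f (conj (c n))
    rw [Complex.conj_conj] at this
    exact this.symm
  have h2 : ‖∑ n ∈ s, conj (c n) • fockBasis n‖ ≤ Real.exp (‖z‖ ^ 2 / 2) := by
    refine abs_le_of_sq_le_sq' ?_ (Real.exp_pos _).le |>.2
    have h3 : ∀ n, ‖c n‖ ^ 2 = (‖z‖ ^ 2) ^ n / n.factorial := fun n => by
      simp only [c]
      rw [norm_div, norm_pow, div_pow, Complex.norm_real,
        Real.norm_of_nonneg (Real.sqrt_nonneg _), Real.sq_sqrt (by positivity), ← pow_mul,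
        ← pow_mul, mul_comm]
    have h4 : ‖∑ n ∈ s, conj (c n) • fockBasis n‖ ^ 2 = ∑ n ∈ s, ‖c n‖ ^ 2 := by
      have := orthonormal_fockBasis.inner_sum (fun n => conj (c n)) (fun n => conj (c n)) s
      rw [inner_self_eq_norm_sq_to_K] at this
      have h5 : ((‖∑ n ∈ s, conj (c n) • fockBasis n‖ ^ 2 : ℝ) : ℂ) =
          ((∑ n ∈ s, ‖c n‖ ^ 2 : ℝ) : ℂ) := by
        push_cast
        rw [← Complex.coe_algebraMap, this]
        refine Finset.sum_congr rfl fun n _ => ?_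
        rw [Complex.conj_conj, Complex.mul_conj, Complex.normSq_eq_norm_sq, Complex.ofReal_pow]
        rfl
      exact_mod_cast h5
    rw [h4, Finset.sum_congr rfl fun n _ => h3 n, ← Real.exp_nat_mul]
    refine ((Real.summable_pow_div_factorial (‖z‖ ^ 2)).sum_le_tsum s
      fun n _ => by positivity).trans (le_of_eq ?_)
    rw [← congrFun NormedSpace.exp_eq_tsum_div (‖z‖ ^ 2), ← congrFun Real.exp_eq_exp_ℝ]
    push_cast
    ring_nf
  rw [h1]
  exact (norm_inner_le_norm _ _).trans (by gcongr)

/-- Evaluation at a point, as a continuous functional on the Bargmann space. -/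
def evalCLM (z : ℂ) : bargmannSpace →L[ℂ] ℂ :=
  LinearMap.mkContinuous
    { toFun := fun f => (entireRep f : ℂ → ℂ) z
      map_add' := fun f g => by rw [map_add]; rfl
      map_smul' := fun c f => by rw [map_smul]; rfl }
    (Real.exp (‖z‖ ^ 2 / 2)) fun f => norm_entireRep_le f z

theorem evalCLM_apply (z : ℂ) (f : bargmannSpace) : evalCLM z f = (entireRep f : ℂ → ℂ) z := rfl

theorem ext_entireRep {f g : bargmannSpace}
    (h : ∀ z, (entireRep f : ℂ → ℂ) z = (entireRep g : ℂ → ℂ) z) : f = g :=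
  entireRep_injective (Subtype.ext (funext h))

/-- The evaluation bound upgrades `L²` convergence to locally uniform convergence, so the pointwise
limit is entire. An almost everywhere convergent subsequence identifies it with the `L²` limit. -/
theorem isClosed_bargmannSpace : IsClosed (bargmannSpace : Set (Lp ℂ 2 bargmannMeasure)) := by
  refine IsSeqClosed.isClosed fun u f hu huf => ?_
  let v : ℕ → bargmannSpace := fun n => ⟨u n, hu n⟩
  have hv : CauchySeq v := by
    have := huf.cauchySeq
    rw [Metric.cauchySeq_iff] at this ⊢
    exact this
  choose G hG using fun z => cauchySeq_tendsto_of_complete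
    ((evalCLM z).uniformContinuous.comp_cauchySeq hv)
  have hloc : TendstoLocallyUniformlyOn (fun n => (entireRep (v n) : ℂ → ℂ)) G Filter.atTop
      Set.univ := by
    rw [tendstoLocallyUniformlyOn_iff_forall_isCompact isOpen_univ]
    intro K _ hK
    refine UniformCauchySeqOn.tendstoUniformlyOn_of_tendsto ?_ fun z _ => hG z
    obtain ⟨B, hB⟩ := hK.isBounded.exists_norm_le
    rw [Metric.uniformCauchySeqOn_iff]
    intro ε hε
    obtain ⟨N, hN⟩ := Metric.cauchySeq_iff.1 hv (ε / Real.exp (B ^ 2 / 2)) (by positivity)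
    refine ⟨N, fun m hm n hn z hz => ?_⟩
    have h1 := norm_entireRep_le (v m - v n) z
    have h2 := hN m hm n hn
    rw [lt_div_iff₀ (Real.exp_pos _), dist_eq_norm] at h2
    rw [map_sub] at h1
    rw [dist_eq_norm]
    refine h1.trans_lt (lt_of_le_of_lt ?_ h2)
    rw [mul_comm]
    have := hB z hz
    gcongr
  have hGd : Differentiable ℂ G := by
    rw [← differentiableOn_univ]
    exact hloc.differentiableOn (Filter.Eventually.of_forall fun n =>
      (differentiable_entireRep (v n)).differentiableOn) isOpen_univ
  obtain ⟨ns, hns, hae⟩ := (tendstoInMeasure_of_tendsto_Lp huf).exists_seq_tendsto_ae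
  refine ⟨G, hGd, ?_⟩
  have hall : ∀ᵐ z ∂bargmannMeasure, ∀ n, u n z = (entireRep (v n) : ℂ → ℂ) z :=
    ae_all_iff.2 fun n => entireRep_ae (v n)
  filter_upwards [hae, hall] with z hz hz2
  simp only [hz2] at hz
  exact tendsto_nhds_unique hz ((hG z).comp hns.tendsto_atTop)

instance completeSpace_bargmannSpace : CompleteSpace bargmannSpace :=
  isClosed_bargmannSpace.completeSpace_coe

/-- The monomials form a Hilbert basis of the Bargmann space. -/
def fockHilbertBasis : HilbertBasis ℕ ℂ bargmannSpace :=
  HilbertBasis.mkOfOrthogonalEqBot orthonormal_fockBasis (by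
    refine (Submodule.eq_bot_iff _).2 fun f hf => ext_entireRep fun z => ?_
    have h := hasSum_entireRep f z
    have h0 : ∀ n, ⟪fockBasis n, f⟫ = 0 := fun n =>
      (Submodule.mem_orthogonal _ _).1 hf _ (Submodule.subset_span ⟨n, rfl⟩)
    simp only [h0, mul_zero] at h
    rw [h.unique hasSum_zero, map_zero]
    rfl)

theorem coe_fockHilbertBasis : ⇑fockHilbertBasis = fockBasis :=
  HilbertBasis.coe_mkOfOrthogonalEqBot _ _

theorem hasSum_inner_fockBasis (f g : bargmannSpace) :
    HasSum (fun n => conj ⟪fockBasis n, f⟫ * ⟪fockBasis n, g⟫) ⟪f, g⟫ := by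
  have h := fockHilbertBasis.hasSum_inner_mul_inner f g
  simpa only [coe_fockHilbertBasis, inner_conj_symm] using h

theorem integrable_gaussian {p : ℝ} (hp : 0 < p) :
    Integrable fun z : ℂ => Real.exp (-p * ‖z‖ ^ 2) := by
  have h := (GaussianFourier.integrable_cexp_neg_mul_sq_norm_add (V := ℂ)
    (b := (p : ℂ)) (by simpa using hp) 0 0).norm
  refine h.congr (Filter.Eventually.of_forall fun z => ?_)
  simp only
  rw [Complex.norm_exp]
  congr 1
  simp [← Complex.ofReal_pow]

theorem integrable_exp_bargmannMeasure {q : ℝ} (hq : q < 1) :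
    Integrable (fun z : ℂ => Real.exp (q * ‖z‖ ^ 2)) bargmannMeasure := by
  rw [bargmannMeasure, integrable_withDensity_iff (by fun_prop) (by simp)]
  refine ((integrable_gaussian (sub_pos.2 hq)).const_mul Real.pi⁻¹).congr
    (Filter.Eventually.of_forall fun z => ?_)
  simp only
  rw [ENNReal.toReal_ofReal (by positivity), mul_left_comm, ← Real.exp_add]
  ring_nf

theorem memLp_of_norm_le {F : ℂ → ℂ} (hF : Continuous F) {C q : ℝ} (hq : q < 1)
    (h : ∀ z, ‖F z‖ ≤ C * Real.exp (q * ‖z‖ ^ 2 / 2)) : MemLp F 2 bargmannMeasure := by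
  rw [memLp_two_iff_integrable_sq_norm hF.aestronglyMeasurable]
  refine ((integrable_exp_bargmannMeasure hq).const_mul (C ^ 2)).mono'
    (by fun_prop) (Filter.Eventually.of_forall fun z => ?_)
  rw [Real.norm_of_nonneg (by positivity)]
  refine (pow_le_pow_left₀ (norm_nonneg _) (h z) 2).trans (le_of_eq ?_)
  rw [mul_pow, ← Real.exp_nat_mul]
  ring_nf

theorem norm_sq_eq_integral (f : bargmannSpace) :
    ‖f‖ ^ 2 = ∫ z, ‖(entireRep f : ℂ → ℂ) z‖ ^ 2 ∂bargmannMeasure := by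
  have h := inner_eq_integral f f
  rw [inner_self_eq_norm_sq_to_K] at h
  have h2 : ∀ z, conj ((entireRep f : ℂ → ℂ) z) * (entireRep f : ℂ → ℂ) z =
      ((‖(entireRep f : ℂ → ℂ) z‖ ^ 2 : ℝ) : ℂ) := fun z => by
    rw [Complex.conj_mul', Complex.ofReal_pow]
  simp only [h2, integral_complex_ofReal] at h
  refine Complex.ofReal_injective (Eq.trans ?_ h)
  rw [Complex.ofReal_pow]
  rfl

/-- Dominated convergence: the squared bound `e^{q|z|²}` with `q < 1` is integrable against the
Gaussian measure. -/
theorem continuousAt_of_norm_le {f : ℝ → bargmannSpace} {t₀ : ℝ}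
    (hc : ∀ z, ContinuousAt (fun t => (entireRep (f t) : ℂ → ℂ) z) t₀) {C q : ℝ} (hq : q < 1)
    (hb : ∀ᶠ t in nhds t₀, ∀ z, ‖(entireRep (f t) : ℂ → ℂ) z‖ ≤
      C * Real.exp (q * ‖z‖ ^ 2 / 2)) : ContinuousAt f t₀ := by
  rw [ContinuousAt, tendsto_iff_norm_sub_tendsto_zero]
  have hsq : Filter.Tendsto (fun t => ‖f t - f t₀‖ ^ 2) (nhds t₀) (nhds 0) := by
    simp only [norm_sq_eq_integral]
    have hsub : ∀ t z, (entireRep (f t - f t₀) : ℂ → ℂ) z =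
      (entireRep (f t) : ℂ → ℂ) z - (entireRep (f t₀) : ℂ → ℂ) z := fun t z => by
      rw [map_sub]; rfl
    have h0 : (0 : ℝ) = ∫ _ : ℂ, (0 : ℝ) ∂bargmannMeasure := by simp
    rw [h0]
    refine tendsto_integral_filter_of_dominated_convergence
      (fun z => (2 * C) ^ 2 * Real.exp (q * ‖z‖ ^ 2)) ?_ ?_
      ((integrable_exp_bargmannMeasure hq).const_mul _) ?_
    · exact Filter.Eventually.of_forall fun t =>
        ((differentiable_entireRep _).continuous.norm.pow 2).aestronglyMeasurable
    · filter_upwards [hb] with t ht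
      refine Filter.Eventually.of_forall fun z => ?_
      rw [Real.norm_of_nonneg (by positivity), hsub]
      have h1 : ‖(entireRep (f t) : ℂ → ℂ) z - (entireRep (f t₀) : ℂ → ℂ) z‖ ≤
          2 * C * Real.exp (q * ‖z‖ ^ 2 / 2) := by
        refine (norm_sub_le _ _).trans ?_
        have := hb.self_of_nhds z
        linarith [ht z]
      refine (pow_le_pow_left₀ (norm_nonneg _) h1 2).trans (le_of_eq ?_)
      rw [mul_pow, ← Real.exp_nat_mul]
      ring_nf
    · refine Filter.Eventually.of_forall fun z => ?_
      simp only [hsub]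
      have h2 := (((hc z).tendsto).sub_const ((entireRep (f t₀) : ℂ → ℂ) z)).norm.pow 2
      simpa using h2
  have := hsq.sqrt
  simpa using this

/-- Point evaluations are continuous and separate vectors, so they identify `f t - f 0` with the
vector-valued integral of `f'`. No estimate on difference quotients is needed. -/
theorem hasDerivAt_of_pointwise {f f' : ℝ → bargmannSpace} (hf' : Continuous f')
    (h : ∀ z t, HasDerivAt (fun t => (entireRep (f t) : ℂ → ℂ) z)
      ((entireRep (f' t) : ℂ → ℂ) z) t) (t : ℝ) : HasDerivAt f (f' t) t := by
  have heq : ∀ t, f t = (∫ s in (0 : ℝ)..t, f' s) + f 0 := by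
    intro t
    refine ext_entireRep fun z => ?_
    have h1 : (∫ s in (0 : ℝ)..t, evalCLM z (f' s)) = evalCLM z (∫ s in (0 : ℝ)..t, f' s) :=
      (evalCLM z).intervalIntegral_comp_comm (hf'.intervalIntegrable _ _)
    rw [← evalCLM_apply, ← evalCLM_apply, map_add, ← h1]
    simp only [evalCLM_apply]
    rw [intervalIntegral.integral_eq_sub_of_hasDerivAt (fun s _ => h z s)
        (((evalCLM z).continuous.comp hf').intervalIntegrable _ _)]
    rw [sub_add_cancel]
  refine HasDerivAt.congr_of_eventuallyEq ?_ (Filter.Eventually.of_forall heq)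
  exact (intervalIntegral.integral_hasDerivAt_right (hf'.intervalIntegrable 0 t)
    (hf'.stronglyMeasurableAtFilter _ _) hf'.continuousAt).add_const (f 0)

theorem iteratedDeriv_id_mul {F : ℂ → ℂ} (hF : Differentiable ℂ F) (n : ℕ) :
    iteratedDeriv (n + 1) (fun z => z * F z) =
      fun z => z * iteratedDeriv (n + 1) F z + (n + 1) * iteratedDeriv n F z := by
  have hd : ∀ n, Differentiable ℂ (iteratedDeriv n F) := fun n =>
    hF.contDiff.differentiable_iteratedDeriv n (WithTop.coe_lt_top _)
  induction n with
  | zero =>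
    funext z
    rw [iteratedDeriv_one, iteratedDeriv_one, deriv_fun_mul differentiableAt_fun_id (hF z)]
    simp [add_comm]
  | succ n ih =>
    funext z
    rw [iteratedDeriv_succ, ih, deriv_fun_add (differentiableAt_fun_id.fun_mul (hd _ z))
      ((hd n z).const_mul _), deriv_fun_mul differentiableAt_fun_id (hd _ z),
      deriv_const_mul _ (hd n z), ← iteratedDeriv_succ, ← iteratedDeriv_succ]
    simp
    ring

end BargmannSpace

/-! ### Skew-symmetry of the squeeze operator on its domain -/

section Operators

theorem iteratedDeriv_sq_mul_zero {F : ℂ → ℂ} (hF : Differentiable ℂ F) (n : ℕ) :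
    iteratedDeriv (n + 2) (fun z => z ^ 2 / 2 * F z) 0 =
      (n + 2) * (n + 1) / 2 * iteratedDeriv n F 0 := by
  have h : (fun z => z ^ 2 / 2 * F z) = fun z => (1 / 2 : ℂ) * (z * (z * F z)) := by
    funext z
    ring
  rw [h, iteratedDeriv_const_mul_field,
    iteratedDeriv_id_mul (differentiable_fun_id.fun_mul hF) (n + 1), iteratedDeriv_id_mul hF n]
  push_cast
  ring

/-- In Taylor coefficients `K₊` and `K₋` are transposed weighted shifts by two, so the Parseval sums
agree term by term. This works directly on the maximal domains, with no core. -/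
theorem inner_Kplus_eq_inner_Kminus {f p g m : bargmannSpace} (hp : (f, p) ∈ Kplus.graph)
    (hm : (g, m) ∈ Kminus.graph) : ⟪p, g⟫ = ⟪f, m⟫ := by
  have hP := congrArg Subtype.val ((mem_maximalOperator_graph _ _ _).1 hp)
  have hM := congrArg Subtype.val ((mem_maximalOperator_graph _ _ _).1 hm)
  have hP' : (entireRep p : ℂ → ℂ) = fun z => z ^ 2 / 2 * (entireRep f : ℂ → ℂ) z := hP
  have hM' : (entireRep m : ℂ → ℂ) =
      fun z => (1 / 2 : ℂ) * deriv (deriv (entireRep g : ℂ → ℂ)) z := hM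
  have h := hasSum_inner_fockBasis p g
  -- The shift by two drops the coefficients of index 0 and 1, which vanish because `p = z² f / 2`.
  rw [← hasSum_nat_add_iff' 2, Finset.sum_range_succ, Finset.sum_range_one] at h
  have h0 : ⟪fockBasis 0, p⟫ = 0 := by
    rw [inner_fockBasis, hP']
    simp
  have h1 : ⟪fockBasis 1, p⟫ = 0 := by
    have heq : (fun z => z ^ 2 / 2 * (entireRep f : ℂ → ℂ) z) =
        fun z => z * (z / 2 * (entireRep f : ℂ → ℂ) z) := by
      funext z
      ring
    have := iteratedDeriv_id_mul ((differentiable_fun_id.div_const (2 : ℂ)).fun_mul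
      (differentiable_entireRep f)) 0
    rw [zero_add] at this
    rw [inner_fockBasis, hP', heq, this]
    simp
  rw [h0, h1, map_zero, zero_mul, zero_mul, add_zero, sub_zero] at h
  refine h.unique ((hasSum_inner_fockBasis f m).congr_fun fun n => ?_)
  rw [inner_fockBasis, inner_fockBasis, inner_fockBasis, inner_fockBasis, hP', hM',
    iteratedDeriv_sq_mul_zero (differentiable_entireRep f), iteratedDeriv_const_mul_field,
    ← iteratedDeriv_succ', ← iteratedDeriv_succ']
  simp only [map_div₀, map_mul, map_add, Complex.conj_natCast, Complex.conj_ofReal, map_one,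
    Complex.conj_ofNat]
  have e1 := ofReal_sqrt_factorial_sq (n + 2)
  have e2 := ofReal_sqrt_factorial_sq n
  have e3 : ((n + 2).factorial : ℂ) = (n + 2) * (n + 1) * n.factorial := by
    rw [Nat.factorial_succ, Nat.factorial_succ]
    push_cast
    ring
  have n1 := ofReal_sqrt_factorial_ne_zero (n + 2)
  have n2 := ofReal_sqrt_factorial_ne_zero n
  rw [div_mul_div_comm, div_mul_div_comm, ← sq, ← sq, e1, e2, e3]
  have n3 : (n.factorial : ℂ) ≠ 0 := by exact_mod_cast n.factorial_ne_zero
  have n4 : (n + 2 : ℂ) ≠ 0 := by exact_mod_cast (n + 1).succ_ne_zero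
  have n5 : (n + 1 : ℂ) ≠ 0 := by exact_mod_cast n.succ_ne_zero
  field_simp

theorem mem_graph_smul_sub_smul {H : Type*} [AddCommGroup H] [Module ℂ H] {A B : H →ₗ.[ℂ] H}
    {a b : ℂ} {x y : H} : (x, y) ∈ (a • A - b • B).graph ↔
      ∃ p q, (x, p) ∈ A.graph ∧ (x, q) ∈ B.graph ∧ y = a • p - b • q := by
  constructor
  · intro h
    obtain ⟨⟨v, hv⟩, rfl, rfl⟩ := LinearPMap.mem_graph_iff _ |>.1 h
    refine ⟨A ⟨v, hv.1⟩, B ⟨v, hv.2⟩, A.mem_graph ⟨v, hv.1⟩, B.mem_graph ⟨v, hv.2⟩, ?_⟩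
    rw [LinearPMap.sub_apply]
    rfl
  · rintro ⟨p, q, hp, hq, rfl⟩
    obtain ⟨⟨v, hv⟩, rfl, rfl⟩ := LinearPMap.mem_graph_iff _ |>.1 hp
    obtain ⟨⟨v', hv'⟩, h, rfl⟩ := LinearPMap.mem_graph_iff _ |>.1 hq
    obtain rfl : v' = v := h
    rw [LinearPMap.mem_graph_iff]
    refine ⟨⟨v', ⟨hv, hv'⟩⟩, rfl, ?_⟩
    rw [LinearPMap.sub_apply]
    rfl

theorem isSkewRelation_squeeze (ξ : ℂ) :
    IsSkewRelation (ξ • Kplus - conj ξ • Kminus).graph := by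
  rintro ⟨f, _⟩ hf ⟨g, _⟩ hg
  obtain ⟨p, m, hp, hm, rfl⟩ := mem_graph_smul_sub_smul.1 hf
  obtain ⟨p', m', hp', hm', rfl⟩ := mem_graph_smul_sub_smul.1 hg
  have h1 := inner_Kplus_eq_inner_Kminus hp hm'
  have h2 : ⟪m, g⟫ = ⟪f, p'⟫ := by
    rw [← inner_conj_symm, ← inner_Kplus_eq_inner_Kminus hp' hm, inner_conj_symm]
  change ⟪ξ • p - conj ξ • m, g⟫ = -⟪f, ξ • p' - conj ξ • m'⟫
  have e1 := inner_smul_left (𝕜 := ℂ) p g ξ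
  have e2 := inner_smul_left (𝕜 := ℂ) m g (conj ξ)
  have e3 := inner_smul_right (𝕜 := ℂ) f p' ξ
  have e4 := inner_smul_right (𝕜 := ℂ) f m' (conj ξ)
  rw [Complex.conj_conj] at e2
  rw [inner_sub_left, inner_sub_right]
  refine (congrArg₂ (· - ·) e1 e2).trans
    (Eq.trans ?_ (congrArg Neg.neg (congrArg₂ (· - ·) e3 e4)).symm)
  rw [h1, h2]
  ring

end Operators

/-! ### Gaussians with quadratic prefactor, and coherent states -/

section QuadraticGaussian

/-- A polynomial of degree at most two times a Gaussian. -/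
def quadGauss (p₀ p₁ p₂ a b c : ℂ) (z : ℂ) : ℂ :=
  (p₀ + p₁ * z + p₂ * z ^ 2) * Complex.exp (a * z ^ 2 / 2 + b * z + c)

theorem differentiable_quadGauss (p₀ p₁ p₂ a b c : ℂ) :
    Differentiable ℂ (quadGauss p₀ p₁ p₂ a b c) := by
  unfold quadGauss
  fun_prop

/-- The polynomial and the linear exponent each cost `(1 - r)/8 · |z|²`. Added to `r |z|²/2` this
gives `(1 + r)/4 · |z|²`, still below the critical `|z|²/2`. The bound is uniform in the parameters,
as dominated convergence requires. -/
theorem norm_quadGauss_le {r M : ℝ} (hr0 : 0 ≤ r) (hr : r < 1) {p₀ p₁ p₂ a b c : ℂ}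
    (ha : ‖a‖ ≤ r) (h0 : ‖p₀‖ ≤ M) (h1 : ‖p₁‖ ≤ M) (h2 : ‖p₂‖ ≤ M) (hb : ‖b‖ ≤ M)
    (hc : ‖c‖ ≤ M) (z : ℂ) : ‖quadGauss p₀ p₁ p₂ a b c z‖ ≤
      12 * M / (1 - r) * Real.exp (M + 2 * M ^ 2 / (1 - r)) *
        Real.exp ((1 + r) / 2 * ‖z‖ ^ 2 / 2) := by
  have hM : 0 ≤ M := (norm_nonneg _).trans h0
  have hd : 0 < 1 - r := by linarith
  set x := ‖z‖ with hx
  have hx0 : 0 ≤ x := norm_nonneg z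
  have hpoly : ‖p₀ + p₁ * z + p₂ * z ^ 2‖ ≤ 12 * M / (1 - r) * Real.exp ((1 - r) / 8 * x ^ 2) := by
    have hn : ‖p₀ + p₁ * z + p₂ * z ^ 2‖ ≤ M + M * x + M * x ^ 2 := by
      refine (norm_add₃_le).trans ?_
      rw [norm_mul, norm_mul, norm_pow]
      gcongr
    have he := Real.add_one_le_exp ((1 - r) / 8 * x ^ 2)
    have h3 : 1 + x ^ 2 ≤ 8 / (1 - r) * Real.exp ((1 - r) / 8 * x ^ 2) := by
      rw [div_mul_eq_mul_div, le_div_iff₀ hd]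
      nlinarith [sq_nonneg x]
    have h4 : M + M * x + M * x ^ 2 ≤ M * (3 / 2 * (1 + x ^ 2)) := by
      nlinarith [mul_nonneg hM (sq_nonneg (x - 1))]
    calc _ ≤ M * (3 / 2 * (1 + x ^ 2)) := hn.trans h4
      _ ≤ M * (3 / 2 * (8 / (1 - r) * Real.exp ((1 - r) / 8 * x ^ 2))) := by gcongr
      _ = _ := by ring
  have hexp : ‖Complex.exp (a * z ^ 2 / 2 + b * z + c)‖ ≤
      Real.exp (M + 2 * M ^ 2 / (1 - r)) * Real.exp (r * x ^ 2 / 2 + (1 - r) / 8 * x ^ 2) := by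
    rw [Complex.norm_exp, ← Real.exp_add]
    refine Real.exp_le_exp.2 ((Complex.re_le_norm _).trans ?_)
    have hn : ‖a * z ^ 2 / 2 + b * z + c‖ ≤ r * x ^ 2 / 2 + M * x + M := by
      refine (norm_add₃_le).trans ?_
      rw [norm_div, norm_mul, norm_mul, norm_pow, Complex.norm_ofNat]
      gcongr
    -- Completing the square absorbs the linear term.
    have hy : M * x ≤ 2 * M ^ 2 / (1 - r) + (1 - r) / 8 * x ^ 2 := by
      rw [← sub_nonneg]
      have : 2 * M ^ 2 / (1 - r) + (1 - r) / 8 * x ^ 2 - M * x =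
          (4 * M - (1 - r) * x) ^ 2 / (8 * (1 - r)) := by
        field_simp
        ring
      rw [this]
      positivity
    linarith
  rw [quadGauss, norm_mul]
  calc _ ≤ 12 * M / (1 - r) * Real.exp ((1 - r) / 8 * x ^ 2) *
        (Real.exp (M + 2 * M ^ 2 / (1 - r)) *
          Real.exp (r * x ^ 2 / 2 + (1 - r) / 8 * x ^ 2)) := by gcongr
    _ = 12 * M / (1 - r) * Real.exp (M + 2 * M ^ 2 / (1 - r)) *
        (Real.exp ((1 - r) / 8 * x ^ 2) * Real.exp (r * x ^ 2 / 2 + (1 - r) / 8 * x ^ 2)) := by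
      ring
    _ = _ := by
      rw [← Real.exp_add]
      ring_nf

theorem memLp_quadGauss (p₀ p₁ p₂ b c : ℂ) {a : ℂ} (ha : ‖a‖ < 1) :
    MemLp (quadGauss p₀ p₁ p₂ a b c) 2 bargmannMeasure := by
  have h0 := norm_nonneg p₀
  have h1 := norm_nonneg p₁
  have h2 := norm_nonneg p₂
  have hb := norm_nonneg b
  have hc := norm_nonneg c
  exact memLp_of_norm_le (differentiable_quadGauss _ _ _ _ _ _).continuous
    (by linarith : (1 + ‖a‖) / 2 < 1) (norm_quadGauss_le
      (M := ‖p₀‖ + ‖p₁‖ + ‖p₂‖ + ‖b‖ + ‖c‖) (norm_nonneg a) ha le_rfl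
      (by linarith) (by linarith) (by linarith) (by linarith) (by linarith))

/-- A polynomial of degree at most two times a Gaussian, as a vector of the Bargmann space. -/
def quadGaussVec (p₀ p₁ p₂ : ℂ) {a : ℂ} (ha : ‖a‖ < 1) (b c : ℂ) : bargmannSpace :=
  ofEntire (quadGauss p₀ p₁ p₂ a b c) (differentiable_quadGauss _ _ _ _ _ _)
    (memLp_quadGauss _ _ _ _ _ ha)

theorem entireRep_quadGaussVec (p₀ p₁ p₂ : ℂ) {a : ℂ} (ha : ‖a‖ < 1) (b c : ℂ) :
    (entireRep (quadGaussVec p₀ p₁ p₂ ha b c) : ℂ → ℂ) = quadGauss p₀ p₁ p₂ a b c :=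
  entireRep_ofEntire _ _ _

theorem continuous_quadGaussVec {p₀ p₁ p₂ a b c : ℝ → ℂ} (ha : ∀ t, ‖a t‖ < 1)
    (h0 : Continuous p₀) (h1 : Continuous p₁) (h2 : Continuous p₂) (hac : Continuous a)
    (hb : Continuous b) (hc : Continuous c) :
    Continuous fun t => quadGaussVec (p₀ t) (p₁ t) (p₂ t) (ha t) (b t) (c t) := by
  refine continuous_iff_continuousAt.2 fun t₀ => ?_
  have hr := ha t₀
  set r := (1 + ‖a t₀‖) / 2 with hrdef
  have hev : ∀ {u : ℝ → ℂ}, Continuous u → ∀ {B : ℝ}, ‖u t₀‖ < B →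
      ∀ᶠ t in nhds t₀, ‖u t‖ ≤ B := fun hu B hB =>
    (hu.norm.continuousAt.eventually_lt_const hB).mono fun _ h => h.le
  have n0 := norm_nonneg (p₀ t₀)
  have n1 := norm_nonneg (p₁ t₀)
  have n2 := norm_nonneg (p₂ t₀)
  have nb := norm_nonneg (b t₀)
  have nc := norm_nonneg (c t₀)
  have na := norm_nonneg (a t₀)
  set M := ‖p₀ t₀‖ + ‖p₁ t₀‖ + ‖p₂ t₀‖ + ‖b t₀‖ + ‖c t₀‖ + 1 with hM
  refine continuousAt_of_norm_le (fun z => ?_) (by linarith : (1 + r) / 2 < 1)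
    (C := 12 * M / (1 - r) * Real.exp (M + 2 * M ^ 2 / (1 - r))) ?_
  · simp only [entireRep_quadGaussVec]
    unfold quadGauss
    fun_prop
  · filter_upwards [hev hac (by linarith : ‖a t₀‖ < r), hev h0 (by linarith : ‖p₀ t₀‖ < M),
      hev h1 (by linarith : ‖p₁ t₀‖ < M), hev h2 (by linarith : ‖p₂ t₀‖ < M),
      hev hb (by linarith : ‖b t₀‖ < M), hev hc (by linarith : ‖c t₀‖ < M)]
      with t ta t0 t1 t2 tb tc z
    rw [entireRep_quadGaussVec]
    exact norm_quadGauss_le (by linarith) (by linarith) ta t0 t1 t2 tb tc z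

theorem deriv_quadGauss_one (a b c : ℂ) : deriv (quadGauss 1 0 0 a b c) =
    quadGauss b a 0 a b c := by
  funext z
  unfold quadGauss
  have h : HasDerivAt (fun z : ℂ => a * z ^ 2 / 2 + b * z + c) (a * z + b) z := by
    have h1 := ((((hasDerivAt_id z).pow 2).const_mul a).div_const 2).add
      (((hasDerivAt_id z).const_mul b).add_const c)
    refine (h1.congr_deriv ?_).congr_of_eventuallyEq (Filter.Eventually.of_forall fun w => ?_)
    · simp
      ring
    · simp
      ring
  have h2 := h.cexp.const_mul ((1 : ℂ))
  simp only [zero_mul, add_zero]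
  rw [h2.deriv]
  ring

theorem deriv_quadGauss_linear (a b c : ℂ) : deriv (quadGauss b a 0 a b c) =
    quadGauss (a + b ^ 2) (2 * a * b) (a ^ 2) a b c := by
  funext z
  have h : HasDerivAt (quadGauss 1 0 0 a b c) (quadGauss b a 0 a b c z) z := by
    rw [← deriv_quadGauss_one]
    exact (differentiable_quadGauss _ _ _ _ _ _ z).hasDerivAt
  have heq : quadGauss b a 0 a b c = fun z => (b + a * z) * quadGauss 1 0 0 a b c z := by
    funext z
    simp only [quadGauss]
    ring
  have h1 : HasDerivAt (fun z : ℂ => b + a * z) a z := by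
    simpa using ((hasDerivAt_id z).const_mul a).const_add b
  have h2 := h1.fun_mul h
  rw [heq, h2.deriv]
  simp only [quadGauss]
  ring

theorem quadGaussVec_mem_Kplus {a : ℂ} (ha : ‖a‖ < 1) (b c : ℂ) :
    (quadGaussVec 1 0 0 ha b c, quadGaussVec 0 0 (1 / 2) ha b c) ∈ Kplus.graph := by
  refine (mem_maximalOperator_graph _ _ _).2 (Subtype.ext (funext fun z => ?_))
  change (entireRep _ : ℂ → ℂ) z = z ^ 2 / 2 * (entireRep _ : ℂ → ℂ) z
  rw [entireRep_quadGaussVec, entireRep_quadGaussVec]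
  simp only [quadGauss]
  ring

theorem quadGaussVec_mem_Kminus {a : ℂ} (ha : ‖a‖ < 1) (b c : ℂ) :
    (quadGaussVec 1 0 0 ha b c,
      quadGaussVec ((a + b ^ 2) / 2) (a * b) (a ^ 2 / 2) ha b c) ∈ Kminus.graph := by
  refine (mem_maximalOperator_graph _ _ _).2 (Subtype.ext (funext fun z => ?_))
  change (entireRep _ : ℂ → ℂ) z = (1 / 2 : ℂ) * deriv (deriv (entireRep _ : ℂ → ℂ)) z
  rw [entireRep_quadGaussVec, entireRep_quadGaussVec, deriv_quadGauss_one,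
    deriv_quadGauss_linear]
  simp only [quadGauss]
  ring

theorem inner_fockBasis_coherent (h : ‖(0 : ℂ)‖ < 1) (b : ℂ) (n : ℕ) :
    ⟪fockBasis n, quadGaussVec 1 0 0 h b 0⟫ = b ^ n / (Real.sqrt n.factorial : ℂ) := by
  have heq : quadGauss 1 0 0 0 b 0 = fun z => Complex.exp (b * z) := by
    funext z
    simp [quadGauss]
  rw [inner_fockBasis, entireRep_quadGaussVec, heq, iteratedDeriv_cexp_const_mul]
  simp

/-- The coherent state `e^{bz}` is the reproducing kernel at `conj b`. A vector orthogonal to all of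
them vanishes at every point, whence totality. -/
theorem inner_coherent (h : ‖(0 : ℂ)‖ < 1) (b : ℂ) (f : bargmannSpace) :
    ⟪quadGaussVec 1 0 0 h b 0, f⟫ = (entireRep f : ℂ → ℂ) (conj b) := by
  refine (hasSum_inner_fockBasis _ f).unique ((hasSum_entireRep f (conj b)).congr_fun fun n => ?_)
  rw [inner_fockBasis_coherent, map_div₀, map_pow, Complex.conj_ofReal]

theorem dense_span_coherent (h : ‖(0 : ℂ)‖ < 1) : Dense (Submodule.span ℂ
    (Set.range fun b => quadGaussVec 1 0 0 h b 0) : Set bargmannSpace) := by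
  refine Submodule.dense_iff_topologicalClosure_eq_top.2
    ((Submodule.topologicalClosure_eq_top_iff).2 ((Submodule.eq_bot_iff _).2 fun f hf => ?_))
  refine ext_entireRep fun z => ?_
  have h1 := (Submodule.mem_orthogonal _ _).1 hf _
    (Submodule.subset_span ⟨conj z, rfl⟩)
  have h2 := inner_coherent h (conj z) f
  rw [Complex.conj_conj] at h2
  rw [← h2, map_zero]
  exact h1

theorem hasSum_coherent (h : ‖(0 : ℂ)‖ < 1) (b : ℂ) :
    HasSum (fun n => (b ^ n / (Real.sqrt n.factorial : ℂ)) • fockBasis n)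
      (quadGaussVec 1 0 0 h b 0) := by
  have hs := fockHilbertBasis.hasSum_repr (quadGaussVec 1 0 0 h b 0)
  refine hs.congr_fun fun n => ?_
  rw [fockHilbertBasis.repr_apply_apply, coe_fockHilbertBasis]
  exact congrArg (· • fockBasis n) (inner_fockBasis_coherent h b n).symm

end QuadraticGaussian

/-! ### Hermite generating function -/

section Hermite

/-- Pairs `(m, k)` of natural numbers, sorted by the value of `2 * m + k`. -/
def weightedPairEquiv : (Σ n : ℕ, Fin (n / 2 + 1)) ≃ ℕ × ℕ where
  toFun p := (p.2, p.1 - 2 * p.2)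
  invFun p := ⟨2 * p.1 + p.2, ⟨p.1, by omega⟩⟩
  left_inv := by
    rintro ⟨n, m, hm⟩
    have h : 2 * m + (n - 2 * m) = n := by omega
    simp only [Sigma.mk.injEq, h, true_and]
    congr!
  right_inv := by
    rintro ⟨m, k⟩
    simp

theorem hasSum_mul_prod {u v : ℕ → ℂ} {a b : ℂ} (hu : HasSum u a) (hv : HasSum v b) :
    HasSum (fun p : ℕ × ℕ => u p.1 * v p.2) (a * b) := by
  have hs : Summable fun p : ℕ × ℕ => u p.1 * v p.2 :=
    summable_mul_of_summable_norm hu.summable.norm hv.summable.norm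
  exact hu.mul hv hs

/-- Multiply the series of `e^{-t²}` and `e^{2xt}` and collect the terms `(m, k)` by the power `2m +
k` of `t`. -/
theorem hasSum_hermiteH (x t : ℂ) : HasSum (fun n : ℕ => t ^ n / n.factorial * hermiteH n x)
    (Complex.exp (2 * x * t - t ^ 2)) := by
  have hexp : ∀ y : ℂ, HasSum (fun n : ℕ => y ^ n / n.factorial) (Complex.exp y) := fun y => by
    rw [Complex.exp_eq_exp_ℂ]
    exact NormedSpace.expSeries_div_hasSum_exp y
  let f : ℕ × ℕ → ℂ := fun p =>
    (-t ^ 2) ^ p.1 / (p.1.factorial : ℂ) * ((2 * x * t) ^ p.2 / (p.2.factorial : ℂ))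
  have h : HasSum f (Complex.exp (2 * x * t - t ^ 2)) := by
    have h := hasSum_mul_prod (hexp (-t ^ 2)) (hexp (2 * x * t))
    rw [← Complex.exp_add, show -t ^ 2 + 2 * x * t = 2 * x * t - t ^ 2 by ring] at h
    exact h
  have h2 : HasSum (fun n => ∑ m : Fin (n / 2 + 1), (f ∘ weightedPairEquiv) ⟨n, m⟩)
    (Complex.exp (2 * x * t - t ^ 2)) :=
    HasSum.sigma ((weightedPairEquiv.hasSum_iff (f := f)).2 h) fun n => hasSum_fintype _
  refine h2.congr_fun fun n => ?_
  have h3 : ∑ m : Fin (n / 2 + 1), (f ∘ weightedPairEquiv) ⟨n, m⟩ =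
      ∑ m ∈ Finset.range (n / 2 + 1), f (m, n - 2 * m) :=
    Fin.sum_univ_eq_sum_range (fun m => f (m, n - 2 * m)) _
  rw [h3, hermiteH, Finset.mul_sum, Finset.mul_sum]
  refine Finset.sum_congr rfl fun m hm => ?_
  have hm' : 2 * m + (n - 2 * m) = n := by
    have := Finset.mem_range.1 hm
    omega
  have e1 : t ^ n = (t ^ 2) ^ m * t ^ (n - 2 * m) := by
    rw [← pow_mul, ← pow_add, hm']
  have n0 : (n.factorial : ℂ) ≠ 0 := by exact_mod_cast n.factorial_ne_zero
  simp only [f]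
  rw [e1, neg_pow (t ^ 2), mul_pow (2 * x) t]
  field_simp

theorem eq_of_hasSum_pow_mul {u v : ℕ → ℂ} {G : ℂ → ℂ}
    (hu : ∀ b, HasSum (fun n => b ^ n * u n) (G b))
    (hv : ∀ b, HasSum (fun n => b ^ n * v n) (G b)) : u = v := by
  have key : ∀ {w : ℕ → ℂ}, (∀ b, HasSum (fun n => b ^ n * w n) (G b)) →
      HasFPowerSeriesAt G (FormalMultilinearSeries.ofScalars ℂ w) 0 := fun hw => by
    rw [hasFPowerSeriesAt_iff]
    refine Filter.Eventually.of_forall fun b => ?_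
    simpa only [FormalMultilinearSeries.coeff_ofScalars, zero_add, smul_eq_mul] using hw b
  have h := (key hu).eq_formalMultilinearSeries (key hv)
  funext n
  rw [← FormalMultilinearSeries.coeff_ofScalars (𝕜 := ℂ) (p := u), h,
    FormalMultilinearSeries.coeff_ofScalars]

end Hermite

/-! ### Explicit flow of coherent states and the squeezed basis -/

section SqueezedCoherent

theorem norm_zero_lt_one : ‖(0 : ℂ)‖ < 1 := by
  rw [norm_zero]
  exact one_pos

theorem hasDerivAt_real_tanh (x : ℝ) : HasDerivAt Real.tanh ((Real.cosh x)⁻¹ ^ 2) x := by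
  have h := (Real.hasDerivAt_sinh x).div (Real.hasDerivAt_cosh x) (Real.cosh_pos x).ne'
  have hc := (Real.cosh_pos x).ne'
  refine (h.congr_deriv ?_).congr_of_eventuallyEq
    (Filter.Eventually.of_forall fun y => Real.tanh_eq_sinh_div_cosh y)
  have := Real.cosh_sq x
  field_simp
  linarith

theorem one_sub_tanh_sq (x : ℝ) : 1 - Real.tanh x ^ 2 = (Real.cosh x)⁻¹ ^ 2 := by
  have := Real.cosh_sq x
  have hc := (Real.cosh_pos x).ne'
  rw [Real.tanh_eq_sinh_div_cosh]
  field_simp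
  linarith

/-- The squeezing parameter at time `t`. -/
def squeezeA (ξ : ℂ) (t : ℝ) : ℂ := (Real.tanh (‖ξ‖ * t) : ℂ) * ξ / (‖ξ‖ : ℂ)

/-- The contraction factor of coherent labels at time `t`. -/
def squeezeB (ξ : ℂ) (t : ℝ) : ℂ := ((Real.cosh (‖ξ‖ * t))⁻¹ : ℝ)

/-- The logarithm of the scalar factor of the squeezed coherent state at time `t`. -/
def squeezeC (ξ b : ℂ) (t : ℝ) : ℂ :=
  -(conj (squeezeA ξ t) * b ^ 2 / 2) - (Real.log (Real.cosh (‖ξ‖ * t)) : ℝ) / 2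

variable {ξ : ℂ} (hξ : ξ ≠ 0)

include hξ

theorem norm_squeezeA (t : ℝ) : ‖squeezeA ξ t‖ = |Real.tanh (‖ξ‖ * t)| := by
  have : ‖ξ‖ ≠ 0 := norm_ne_zero_iff.2 hξ
  rw [squeezeA, norm_div, norm_mul, Complex.norm_real, Complex.norm_real, norm_norm,
    mul_div_cancel_right₀ _ this, Real.norm_eq_abs]

theorem norm_squeezeA_lt_one (t : ℝ) : ‖squeezeA ξ t‖ < 1 := by
  rw [norm_squeezeA hξ]
  exact Real.abs_tanh_lt_one _

theorem conj_mul_squeezeA (t : ℝ) :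
    conj ξ * squeezeA ξ t = (‖ξ‖ : ℂ) * (Real.tanh (‖ξ‖ * t) : ℂ) := by
  have h0 : (‖ξ‖ : ℂ) ≠ 0 := by exact_mod_cast norm_ne_zero_iff.2 hξ
  have h : conj ξ * ξ = (‖ξ‖ : ℂ) ^ 2 := Complex.conj_mul' ξ
  rw [squeezeA, mul_div_assoc', mul_left_comm, h]
  field_simp

/-- This is `sech² = 1 - tanh²`, written so that the derivative of `squeezeA` becomes the right side
of the Riccati equation. -/
theorem squeezeB_sq (t : ℝ) : ξ * squeezeB ξ t ^ 2 = ξ - conj ξ * squeezeA ξ t ^ 2 := by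
  have h0 : (‖ξ‖ : ℂ) ≠ 0 := by exact_mod_cast norm_ne_zero_iff.2 hξ
  have h1 : squeezeB ξ t ^ 2 = 1 - (Real.tanh (‖ξ‖ * t) : ℂ) ^ 2 := by
    rw [squeezeB, ← Complex.ofReal_pow, ← one_sub_tanh_sq]
    push_cast
    rfl
  rw [h1, sq (squeezeA ξ t), ← mul_assoc, conj_mul_squeezeA hξ, squeezeA]
  field_simp

theorem hasDerivAt_squeezeA (t : ℝ) :
    HasDerivAt (squeezeA ξ) (ξ - conj ξ * squeezeA ξ t ^ 2) t := by
  have h0 : (‖ξ‖ : ℂ) ≠ 0 := by exact_mod_cast norm_ne_zero_iff.2 hξ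
  have h1 : HasDerivAt (fun t : ℝ => Real.tanh (‖ξ‖ * t))
      ((Real.cosh (‖ξ‖ * t))⁻¹ ^ 2 * ‖ξ‖) t := by
    have := (hasDerivAt_real_tanh (‖ξ‖ * t)).comp t ((hasDerivAt_id t).const_mul ‖ξ‖)
    rwa [mul_one] at this
  have h2 := (h1.ofReal_comp.mul_const ξ).div_const (‖ξ‖ : ℂ)
  refine h2.congr_deriv ?_
  rw [← squeezeB_sq hξ, squeezeB]
  push_cast
  field_simp

theorem hasDerivAt_squeezeB (t : ℝ) :
    HasDerivAt (squeezeB ξ) (-(conj ξ * squeezeA ξ t * squeezeB ξ t)) t := by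
  have hc := (Real.cosh_pos (‖ξ‖ * t)).ne'
  have h1 : HasDerivAt (fun t : ℝ => (Real.cosh (‖ξ‖ * t))⁻¹)
      (-(‖ξ‖ * Real.tanh (‖ξ‖ * t) * (Real.cosh (‖ξ‖ * t))⁻¹)) t := by
    have h2 := (((Real.hasDerivAt_cosh (‖ξ‖ * t)).comp t
      ((hasDerivAt_id t).const_mul ‖ξ‖))).inv hc
    refine h2.congr_deriv ?_
    simp only [Function.comp_apply, mul_one]
    rw [Real.tanh_eq_sinh_div_cosh]
    field_simp
  refine h1.ofReal_comp.congr_deriv ?_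
  rw [conj_mul_squeezeA hξ, squeezeB]
  push_cast
  ring

theorem hasDerivAt_squeezeC (b : ℂ) (t : ℝ) : HasDerivAt (squeezeC ξ b)
    (-(conj ξ / 2 * (squeezeA ξ t + (squeezeB ξ t * b) ^ 2))) t := by
  have hc := (Real.cosh_pos (‖ξ‖ * t)).ne'
  have h1 : HasDerivAt (fun t : ℝ => Real.log (Real.cosh (‖ξ‖ * t)))
      (‖ξ‖ * Real.tanh (‖ξ‖ * t)) t := by
    have h2 := (((Real.hasDerivAt_cosh (‖ξ‖ * t)).comp t
      ((hasDerivAt_id t).const_mul ‖ξ‖))).log hc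
    refine h2.congr_deriv ?_
    simp only [Function.comp_apply, mul_one]
    rw [Real.tanh_eq_sinh_div_cosh]
    field_simp
  have h3 : HasDerivAt (fun t => conj (squeezeA ξ t)) (conj ξ * squeezeB ξ t ^ 2) t := by
    have h4 := (hasDerivAt_squeezeA hξ t).star
    rw [← squeezeB_sq hξ] at h4
    refine h4.congr_deriv ?_
    change conj (ξ * squeezeB ξ t ^ 2) = _
    rw [map_mul, map_pow, squeezeB, Complex.conj_ofReal]
  have h5 := ((h3.mul_const (b ^ 2)).div_const 2).fun_neg.fun_sub (h1.ofReal_comp.div_const 2)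
  refine h5.congr_deriv ?_
  have h6 := conj_mul_squeezeA hξ t
  rw [mul_add, div_mul_eq_mul_div, h6, Complex.ofReal_mul]
  ring

/-- The squeezed coherent state at time `t`. -/
def squeezedCoherent (b : ℂ) (t : ℝ) : bargmannSpace :=
  quadGaussVec 1 0 0 (norm_squeezeA_lt_one hξ t) (squeezeB ξ t * b) (squeezeC ξ b t)

/-- The time derivative of the squeezed coherent state. -/
def squeezedCoherentDeriv (b : ℂ) (t : ℝ) : bargmannSpace :=
  quadGaussVec (-(conj ξ / 2 * (squeezeA ξ t + (squeezeB ξ t * b) ^ 2)))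
    (-(conj ξ * squeezeA ξ t * (squeezeB ξ t * b))) ((ξ - conj ξ * squeezeA ξ t ^ 2) / 2)
    (norm_squeezeA_lt_one hξ t) (squeezeB ξ t * b) (squeezeC ξ b t)

/-- Applying the operator to a Gaussian multiplies it by a polynomial of degree at most two. Its
coefficients are the time derivatives of the parameters in the exponent. -/
theorem squeezedCoherent_mem_graph (b : ℂ) (t : ℝ) :
    (squeezedCoherent hξ b t, squeezedCoherentDeriv hξ b t) ∈
      (ξ • Kplus - conj ξ • Kminus).graph := by
  refine mem_graph_smul_sub_smul.2 ⟨_, _, quadGaussVec_mem_Kplus _ _ _,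
    quadGaussVec_mem_Kminus _ _ _, ext_entireRep fun z => ?_⟩
  rw [map_sub, map_smul, map_smul]
  change _ = ξ * (entireRep _ : ℂ → ℂ) z - conj ξ * (entireRep _ : ℂ → ℂ) z
  rw [squeezedCoherentDeriv, entireRep_quadGaussVec, entireRep_quadGaussVec,
    entireRep_quadGaussVec]
  simp only [quadGauss]
  ring

theorem hasDerivAt_squeezedCoherent (b : ℂ) (t : ℝ) :
    HasDerivAt (squeezedCoherent hξ b) (squeezedCoherentDeriv hξ b t) t := by
  have cA : Continuous (squeezeA ξ) :=
    continuous_iff_continuousAt.2 fun t => (hasDerivAt_squeezeA hξ t).continuousAt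
  have cB : Continuous (squeezeB ξ) :=
    continuous_iff_continuousAt.2 fun t => (hasDerivAt_squeezeB hξ t).continuousAt
  have cC : Continuous (squeezeC ξ b) :=
    continuous_iff_continuousAt.2 fun t => (hasDerivAt_squeezeC hξ b t).continuousAt
  refine hasDerivAt_of_pointwise (f' := squeezedCoherentDeriv hξ b)
    (continuous_quadGaussVec _ (by fun_prop) (by fun_prop) (by fun_prop) cA (by fun_prop) cC)
    (fun z t => ?_) t
  simp only [squeezedCoherent, squeezedCoherentDeriv, entireRep_quadGaussVec, quadGauss]
  have h := ((((hasDerivAt_squeezeA hξ t).mul_const (z ^ 2)).div_const 2).fun_add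
    (((hasDerivAt_squeezeB hξ t).mul_const b).mul_const z)).fun_add
      (hasDerivAt_squeezeC hξ b t)
  simp only [zero_mul, add_zero, one_mul]
  refine h.cexp.congr_deriv ?_
  ring

theorem squeezedCoherent_zero (b : ℂ) :
    squeezedCoherent hξ b 0 = quadGaussVec 1 0 0 norm_zero_lt_one b 0 := by
  refine ext_entireRep fun z => ?_
  rw [squeezedCoherent, entireRep_quadGaussVec, entireRep_quadGaussVec]
  simp [quadGauss, squeezeA, squeezeB, squeezeC]

theorem exists_isUnitaryExp_squeezeGenerator :
    ∃ S, IsUnitaryExp (squeezeGenerator ξ) S ∧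
      (∀ S', IsUnitaryExp (squeezeGenerator ξ) S' → S' = S) ∧
      ∀ b, S (quadGaussVec 1 0 0 norm_zero_lt_one b 0) = squeezedCoherent hξ b 1 := by
  obtain ⟨S, h1, h2, h3⟩ := exists_isUnitaryExp_of_curves (isSkewRelation_squeeze ξ)
    (squeezedCoherent_mem_graph hξ) (hasDerivAt_squeezedCoherent hξ)
    (by simp only [squeezedCoherent_zero]; exact dense_span_coherent _)
  refine ⟨S, h1, h2, fun b => ?_⟩
  rw [← h3, squeezedCoherent_zero]

omit hξ in
theorem squeezeA_one (ξ : ℂ) : squeezeA ξ 1 = squeezeParam ξ := by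
  rw [squeezeA, mul_one, squeezeParam]

theorem one_sub_norm_squeezeParam_sq :
    1 - ‖squeezeParam ξ‖ ^ 2 = (Real.cosh ‖ξ‖)⁻¹ ^ 2 := by
  rw [← squeezeA_one, norm_squeezeA hξ, mul_one, sq_abs, one_sub_tanh_sq]

theorem squeezeParam_ne_zero : squeezeParam ξ ≠ 0 := by
  have h : 0 < ‖ξ‖ := norm_pos_iff.2 hξ
  have ht : Real.tanh ‖ξ‖ ≠ 0 := by
    rw [Real.tanh_eq_sinh_div_cosh]
    exact (div_pos (Real.sinh_pos_iff.2 h) (Real.cosh_pos _)).ne'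
  rw [← norm_ne_zero_iff, ← squeezeA_one, norm_squeezeA hξ, mul_one]
  exact abs_ne_zero.2 ht

theorem entireRep_squeezed_apply {S : bargmannSpace ≃ₗᵢ[ℂ] bargmannSpace}
    (hS : ∀ b, S (quadGaussVec 1 0 0 norm_zero_lt_one b 0) = squeezedCoherent hξ b 1) {w : ℂ}
    (hw : w ^ 2 = conj (squeezeParam ξ)) (z : ℂ) (n : ℕ) :
    (entireRep (S (fockBasis n)) : ℂ → ℂ) z =
      (((1 - ‖squeezeParam ξ‖ ^ 2) ^ (1 / 4 : ℝ) : ℝ) : ℂ) *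
        Complex.exp (squeezeParam ξ / 2 * z ^ 2) *
        (w ^ n / (Real.sqrt (2 ^ n * (n.factorial : ℝ)) : ℂ)) *
        hermiteH n ((Real.sqrt ((1 - ‖squeezeParam ξ‖ ^ 2) / 2) : ℂ) / w * z) := by
  have hw0 : w ≠ 0 := by
    rintro rfl
    rw [zero_pow two_ne_zero, eq_comm, map_eq_zero] at hw
    exact squeezeParam_ne_zero hξ hw
  set x := (Real.sqrt ((1 - ‖squeezeParam ξ‖ ^ 2) / 2) : ℂ) / w * z with hx
  set A := (((1 - ‖squeezeParam ξ‖ ^ 2) ^ (1 / 4 : ℝ) : ℝ) : ℂ) *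
        Complex.exp (squeezeParam ξ / 2 * z ^ 2) with hA
  have hr0 : (Real.sqrt 2 : ℂ) ≠ 0 := by exact_mod_cast (Real.sqrt_pos.2 two_pos).ne'
  have hr2 : (Real.sqrt 2 : ℂ) ^ 2 = 2 := by
    rw [← Complex.ofReal_pow, Real.sq_sqrt zero_le_two, Complex.ofReal_ofNat]
  have hsqrt : (Real.sqrt ((1 - ‖squeezeParam ξ‖ ^ 2) / 2) : ℂ) =
      squeezeB ξ 1 / (Real.sqrt 2 : ℂ) := by
    rw [one_sub_norm_squeezeParam_sq hξ, Real.sqrt_div (by positivity),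
      Real.sqrt_sq (by positivity), squeezeB, mul_one, Complex.ofReal_div]
  -- Since `1 - |ζ|² = cosh⁻²|ξ|`, the fourth root is `cosh^{-1/2}|ξ|`, the part of `exp (squeezeC ξ
  -- b 1)` independent of `b`.
  have hpow : (((1 - ‖squeezeParam ξ‖ ^ 2) ^ (1 / 4 : ℝ) : ℝ) : ℂ) =
      Complex.exp (-((Real.log (Real.cosh ‖ξ‖) : ℝ) : ℂ) / 2) := by
    rw [one_sub_norm_squeezeParam_sq hξ, Real.rpow_def_of_pos (by positivity), Real.log_pow,
      Real.log_inv, Complex.ofReal_exp]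
    congr 1
    push_cast
    ring
  have h1 : ∀ b, HasSum (fun n : ℕ => b ^ n * ((entireRep (S (fockBasis n)) : ℂ → ℂ) z /
      (Real.sqrt n.factorial : ℂ))) ((entireRep (squeezedCoherent hξ b 1) : ℂ → ℂ) z) := by
    intro b
    have h := ((evalCLM z).comp S.toContinuousLinearEquiv.toContinuousLinearMap).hasSum
      (hasSum_coherent norm_zero_lt_one b)
    rw [← hS]
    refine HasSum.congr_fun h fun n => ?_
    rw [map_smul, smul_eq_mul, div_mul_eq_mul_div, mul_div_assoc]
    rfl
  -- The Hermite generating function is taken at `t = b w / √2`: then `t² = conj ζ b²/2` matches the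
  -- quadratic term in `b`, and `x` is scaled so that `2 x t` is the linear one. Only `w²` enters
  -- the sum, so either root is allowed.
  have h2 : ∀ b, HasSum (fun n : ℕ => b ^ n * (A * (w / (Real.sqrt 2 : ℂ)) ^ n / n.factorial *
      hermiteH n x)) ((entireRep (squeezedCoherent hξ b 1) : ℂ → ℂ) z) := by
    intro b
    have h := (hasSum_hermiteH x (b * (w / (Real.sqrt 2 : ℂ)))).mul_left A
    have heq : (entireRep (squeezedCoherent hξ b 1) : ℂ → ℂ) z =
        A * Complex.exp (2 * x * (b * (w / (Real.sqrt 2 : ℂ))) -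
          (b * (w / (Real.sqrt 2 : ℂ))) ^ 2) := by
      rw [squeezedCoherent, entireRep_quadGaussVec, quadGauss, hA, hpow, ← Complex.exp_add,
        ← Complex.exp_add, zero_mul, zero_mul, add_zero, add_zero, one_mul, squeezeC,
        squeezeA_one, mul_one, ← hw]
      congr 1
      have e1 : 2 * x * (b * (w / (Real.sqrt 2 : ℂ))) = squeezeB ξ 1 * b * z := by
        rw [hx, hsqrt]
        field_simp
        rw [hr2]
        ring
      have e2 : (b * (w / (Real.sqrt 2 : ℂ))) ^ 2 = w ^ 2 * b ^ 2 / 2 := by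
        rw [mul_pow, div_pow, hr2]
        ring
      rw [e1, e2]
      ring
    rw [heq]
    refine h.congr_fun fun n => ?_
    rw [mul_pow]
    ring
  have h3 := congrFun (eq_of_hasSum_pow_mul h1 h2) n
  have hf0 := ofReal_sqrt_factorial_ne_zero n
  rw [div_eq_iff hf0] at h3
  have hsq : Real.sqrt (2 ^ n) = Real.sqrt 2 ^ n := by
    rw [Real.sqrt_eq_iff_mul_self_eq (by positivity) (by positivity), ← mul_pow,
      Real.mul_self_sqrt zero_le_two]
  rw [h3, Real.sqrt_mul (by positivity), hsq, ← ofReal_sqrt_factorial_sq, div_pow]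
  push_cast
  field_simp

end SqueezedCoherent

theorem mainTheorem1 (ξ : ℂ) (hξ : ξ ≠ 0) :
    (∃! S : bargmannSpace ≃ₗᵢ[ℂ] bargmannSpace, IsUnitaryExp (squeezeGenerator ξ) S) ∧
    ∀ (n : ℕ) (w : ℂ), w ^ 2 = conj (squeezeParam ξ) → ∀ z : ℂ,
      (entireRep (squeezedBasis ξ n) : ℂ → ℂ) z =
        (((1 - ‖squeezeParam ξ‖ ^ 2) ^ (1 / 4 : ℝ) : ℝ) : ℂ) *
          Complex.exp (squeezeParam ξ / 2 * z ^ 2) *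
          (w ^ n / (Real.sqrt (2 ^ n * (n.factorial : ℝ)) : ℂ)) *
          hermiteH n ((Real.sqrt ((1 - ‖squeezeParam ξ‖ ^ 2) / 2) : ℂ) / w * z) := by
  obtain ⟨S, h1, h2, h3⟩ := exists_isUnitaryExp_squeezeGenerator hξ
  refine ⟨⟨S, h1, h2⟩, fun n w hw z => ?_⟩
  rw [squeezedBasis, squeezeOperator, unitaryExp_eq h1 h2]
  exact entireRep_squeezed_apply hξ h3 hw z n

end
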